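/- Let $n \ge 2$ and let $\widetilde{Ein}_{1,n-1} = \mathbb{S}^{n-1} \times \mathbb{R}$ be the universal Einstein universe, with the conformal class of $d\sigma^2 - dt^2$ ($d\sigma^2$ the round metric, with distance $d$) and time-oriented by $\partial_t$. Two of its points $p = (x,t)$ and $q$ are conjugate if $q = (-x, t+\pi)$. Let $\Omega \subset \widetilde{Ein}_{1,n-1}$ be a causally convex open subset without conjugate points, that is: every causal curve joining two points of $\Omega$ lies in $\Omega$, and no two points of $\Omega$ are conjugate. (1) There are an open set $U \subset \mathbb{S}^{n-1}$ and functions $f^- < f^+$ from $U$ to $\mathbb{R}$, $1$-Lipschitz for $d$, whose continuous extensions to $\partial U$ coincide, such that $$\Omega = \{(x,t) \in U \times \mathbb{R} :\ f^-(x) < t < f^+(x)\}.$$ (2) For all such $U$, $f^-$, $f^+$, the future causal boundary of $\Omega$ is homeomorphic to the graph of $f^+$, and the past causal boundary of $\Omega$ is homeomorphic to the graph of $f^-$. (3) $\Omega$ has a Cauchy hypersurface (a subset of $\Omega$ that every inextensible causal curve of $\Omega$ meets exactly once), and for every Cauchy hypersurface $S$ of $\Omega$ the causal completion of $\Omega$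 is homeomorphic to $S \times [0,1]$. The causal completion of $\Omega$ is an $n$-dimensional topological manifold with boundary. Here chronological and causal futures and pasts $I^\pm$, $J^\pm$ are taken in the spacetime $\Omega$. An indecomposable past set (IP) is a non-empty open set $P \subset \Omega$ with $I^-(P) \subset P$ that is not the union of two proper open subsets with the same property. The set of IPs carries the topology generated by the sets $\{P : P \cap V \neq \emptyset\}$, for $V = I^+(p)$ or $V = \Omega \setminus J^-(p)$, and the sets $\{P : \overline{P} \subset V\}$, for $V = I^-(p)$ or $V = \Omega \setminus J^+(p)$, where $p \in \Omega$ and $\overline{P}$ is the closure in $\Omega$. Indecomposable future sets (IFs) and their topology are defined in the same way for the reverse time-orientation. The future (resp. past) causal boundary is the subspace of the IPs (resp. IFs) of the form $I^-(\gamma)$ (resp. $I^+(\gamma)$) where $\gamma$ is a causal curve of $\Omega$ that is inextensible in the future (resp. past). The causal completion is the quotient space of the disjoint union of the spaces of IPs and of IFs obtained by identifying $I^-(p)$ with $I^+(p)$ for every $p \in \Omega$. -/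

import Mathlib

open Set Filter Topology

noncomputable section

namespace EinsteinUniverse

/-! ## Ideal points of a set with a chronological and a causal relation

`chron p q` is to be read "`q` lies in the chronological future of `p`", and `causal p q`
"`q` lies in the causal future of `p`".  The notions for the reverse time-orientation are those
for the flipped relations. -/

section IdealPoints

variable {M : Type*} [TopologicalSpace M]

/-- A past set contains the chronological past of each of its points. -/
def IsPastSet (chron : M → M → Prop) (P : Set M) : Prop :=
  ∀ p q, q ∈ P → chron p q → p ∈ P

/-- Indecomposable past sets: the non-empty open past sets that are not the union of two proper
open past subsets. -/
def IsIP (chron : M → M → Prop) (P : Set M) : Prop :=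
  P.Nonempty ∧ IsOpen P ∧ IsPastSet chron P ∧
    ∀ V W : Set M, IsOpen V → IsPastSet chron V → IsOpen W → IsPastSet chron W →
      P = V ∪ W → P = V ∨ P = W

/-- The set of indecomposable past sets. -/
def IPSpace (chron : M → M → Prop) : Type _ := {P : Set M // IsIP chron P}

/-- The topology on the set of indecomposable past sets, generated by
* the sets of those `P` that meet `U`, where `U = I⁺(p)` or `U = M ∖ J⁻(p)`;
* the sets of those `P` with closure contained in `U`, where `U = I⁻(p)` or `U = M ∖ J⁺(p)`. -/
@[reducible] def ipTopology (chron causal : M → M → Prop) : TopologicalSpace (IPSpace chron) :=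
  TopologicalSpace.generateFrom
    {O | ∃ p : M,
      O = {P | (P.1 ∩ {q | chron p q}).Nonempty} ∨
      O = {P | (P.1 ∩ {q | causal q p}ᶜ).Nonempty} ∨
      O = {P | closure P.1 ⊆ {q | chron q p}} ∨
      O = {P | closure P.1 ⊆ {q | causal p q}ᶜ}}

end IdealPoints

/-! ## The universal Einstein universe -/

variable {n : ℕ}

/-- The unit sphere of dimension `n - 1`. -/
abbrev Sphere (n : ℕ) : Type := Metric.sphere (0 : EuclideanSpace ℝ (Fin n)) 1

/-- The universal Einstein universe of dimension `n`, as the product of the sphere and the line. -/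
abbrev Ein (n : ℕ) : Type := Sphere n × ℝ

/-- The distance of the round metric on the sphere. -/
def sphereDist (x y : Sphere n) : ℝ :=
  InnerProductGeometry.angle (x : EuclideanSpace ℝ (Fin n)) (y : EuclideanSpace ℝ (Fin n))

/-- The conformal transformation `(x, t) ↦ (-x, t + π)`. -/
def sigma (p : Ein n) : Ein n := (-p.1, p.2 + Real.pi)

/-- No two points of `Ω` are conjugate. -/
def NoConjugatePoints (Ω : Set (Ein n)) : Prop :=
  ∀ p ∈ Ω, ∀ q ∈ Ω, q ≠ sigma p

/-! ### Causal and timelike curves -/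

/-- The inclusion into `ℝⁿ × ℝ`, in which tangent vectors of the Einstein universe are taken. -/
def incl (p : Ein n) : EuclideanSpace ℝ (Fin n) × ℝ := (p.1, p.2)

/-- The quadratic form of the Lorentzian metric (round metric minus `dt²`) on tangent vectors. -/
def lorentz (w : EuclideanSpace ℝ (Fin n) × ℝ) : ℝ := ‖w.1‖ ^ 2 - w.2 ^ 2

/-- Future-directed timelike vectors. -/
def futureTimelike (n : ℕ) : Set (EuclideanSpace ℝ (Fin n) × ℝ) := {w | lorentz w < 0 ∧ 0 < w.2}

/-- Future-directed causal vectors (non-zero, timelike or lightlike). -/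
def futureCausal (n : ℕ) : Set (EuclideanSpace ℝ (Fin n) × ℝ) :=
  {w | w ≠ 0 ∧ lorentz w ≤ 0 ∧ 0 ≤ w.2}

/-- `γ` restricted to the interval `I` is a continuous, piecewise differentiable curve with tangent
vectors in `C`: it has a tangent vector in `C` at every parameter of `I`, except at break points,
of which there are finitely many between any two parameters. -/
def IsCurveDirectedBy (C : Set (EuclideanSpace ℝ (Fin n) × ℝ)) (I : Set ℝ) (γ : ℝ → Ein n) : Prop :=
  I.OrdConnected ∧ I.Nontrivial ∧ ContinuousOn γ I ∧
    ∃ B : Set ℝ, (∀ a ∈ I, ∀ b ∈ I, (B ∩ Icc a b).Finite) ∧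
      ∀ s ∈ I \ B, ∃ w ∈ C, HasDerivWithinAt (fun u => incl (γ u)) w I s

/-- Future-directed timelike curves. -/
def IsTimelikeCurve (I : Set ℝ) (γ : ℝ → Ein n) : Prop := IsCurveDirectedBy (futureTimelike n) I γ

/-- Future-directed causal curves. -/
def IsCausalCurve (I : Set ℝ) (γ : ℝ → Ein n) : Prop := IsCurveDirectedBy (futureCausal n) I γ

/-- Every causal curve of the Einstein universe that joins two points of `Ω` lies in `Ω`. -/
def CausallyConvex (Ω : Set (Ein n)) : Prop :=
  ∀ (a b : ℝ) (γ : ℝ → Ein n), a < b → IsCausalCurve (Icc a b) γ → γ a ∈ Ω → γ b ∈ Ω →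
    ∀ s ∈ Icc a b, γ s ∈ Ω

/-! ### The causality of the spacetime `Ω` -/

/-- `q` lies in the chronological future `I⁺(p, Ω)`: a timelike curve in `Ω` leads from `p` to
`q`. -/
def Chron (Ω : Set (Ein n)) (p q : Ω) : Prop :=
  ∃ (a b : ℝ) (γ : ℝ → Ein n), a < b ∧ IsTimelikeCurve (Icc a b) γ ∧ (∀ s ∈ Icc a b, γ s ∈ Ω) ∧
    γ a = p ∧ γ b = q

/-- `q` lies in the causal future `J⁺(p, Ω)`: `q = p`, or a causal curve in `Ω` leads from `p` to
`q`. -/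
def Causal (Ω : Set (Ein n)) (p q : Ω) : Prop :=
  p = q ∨ ∃ (a b : ℝ) (γ : ℝ → Ein n), a < b ∧ IsCausalCurve (Icc a b) γ ∧
    (∀ s ∈ Icc a b, γ s ∈ Ω) ∧ γ a = p ∧ γ b = q

/-- `γ`, defined on `I`, is a causal curve of `Ω` without future endpoint in `Ω`.  (If `I` has a
greatest element `b`, then `γ b` is such an endpoint.) -/
def IsFutureInextensible (Ω : Set (Ein n)) (I : Set ℝ) (γ : ℝ → Ein n) : Prop :=
  IsCausalCurve I γ ∧ (∀ s ∈ I, γ s ∈ Ω) ∧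
    ∀ p ∈ Ω, ¬ Tendsto (fun s : I => γ s) atTop (𝓝 p)

/-- `γ`, defined on `I`, is a causal curve of `Ω` without past endpoint in `Ω`. -/
def IsPastInextensible (Ω : Set (Ein n)) (I : Set ℝ) (γ : ℝ → Ein n) : Prop :=
  IsCausalCurve I γ ∧ (∀ s ∈ I, γ s ∈ Ω) ∧
    ∀ p ∈ Ω, ¬ Tendsto (fun s : I => γ s) atBot (𝓝 p)

/-- A Cauchy hypersurface of `Ω`: a subset that every inextensible causal curve of `Ω` meets
exactly once. -/
def IsCauchyHypersurface (Ω S : Set (Ein n)) : Prop :=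
  S ⊆ Ω ∧ ∀ (I : Set ℝ) (γ : ℝ → Ein n), IsFutureInextensible Ω I γ → IsPastInextensible Ω I γ →
    ∃! s, s ∈ I ∧ γ s ∈ S

/-! ### Causal boundary and causal completion of `Ω` -/

/-- The space of indecomposable past sets of `Ω`. -/
def IP (Ω : Set (Ein n)) : Type := IPSpace (Chron Ω)

instance (Ω : Set (Ein n)) : TopologicalSpace (IP Ω) := ipTopology (Chron Ω) (Causal Ω)

/-- The space of indecomposable future sets of `Ω`. -/
def IF (Ω : Set (Ein n)) : Type := IPSpace (flip (Chron Ω))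

instance (Ω : Set (Ein n)) : TopologicalSpace (IF Ω) :=
  ipTopology (flip (Chron Ω)) (flip (Causal Ω))

/-- Terminal indecomposable past sets: the chronological pasts of future-inextensible causal
curves. -/
def IsTIP (Ω : Set (Ein n)) (P : IP Ω) : Prop :=
  ∃ (I : Set ℝ) (γ : ℝ → Ein n), IsFutureInextensible Ω I γ ∧
    P.1 = {q : Ω | ∃ r : Ω, (∃ s ∈ I, γ s = r) ∧ Chron Ω q r}

/-- Terminal indecomposable future sets: the chronological futures of past-inextensible causal
curves. -/
def IsTIF (Ω : Set (Ein n)) (F : IF Ω) : Prop :=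
  ∃ (I : Set ℝ) (γ : ℝ → Ein n), IsPastInextensible Ω I γ ∧
    F.1 = {q : Ω | ∃ r : Ω, (∃ s ∈ I, γ s = r) ∧ Chron Ω r q}

/-- The future causal boundary, as a subspace of the space of indecomposable past sets. -/
abbrev FutureCausalBoundary (Ω : Set (Ein n)) : Type := {P : IP Ω // IsTIP Ω P}

/-- The past causal boundary, as a subspace of the space of indecomposable future sets. -/
abbrev PastCausalBoundary (Ω : Set (Ein n)) : Type := {F : IF Ω // IsTIF Ω F}

/-- The identification of `I⁻(p)` with `I⁺(p)`, for `p` in `Ω`. -/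
def Identified (Ω : Set (Ein n)) (a b : IP Ω ⊕ IF Ω) : Prop :=
  ∃ (p : Ω) (P : IP Ω) (F : IF Ω), P.1 = {q | Chron Ω q p} ∧ F.1 = {q | Chron Ω p q} ∧
    a = Sum.inl P ∧ b = Sum.inr F

/-- The causal completion of `Ω`, with the quotient topology of the disjoint union of the spaces of
indecomposable past sets and of indecomposable future sets. -/
abbrev CausalCompletion (Ω : Set (Ein n)) : Type := Quot (Identified Ω)

/-! ### Regions between two graphs -/

/-- `f` is `1`-Lipschitz on `U` for the round distance. -/
def LipschitzOneOn (f : Sphere n → ℝ) (U : Set (Sphere n)) : Prop :=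
  ∀ x ∈ U, ∀ y ∈ U, |f x - f y| ≤ sphereDist x y

/-- `Ω` is the region between the graphs of the `1`-Lipschitz functions `fm < fp` on the open set
`U`, whose continuous extensions to the boundary of `U` coincide. -/
structure IsRegionBetween (Ω : Set (Ein n)) (U : Set (Sphere n)) (fm fp : Sphere n → ℝ) : Prop where
  isOpen : IsOpen U
  lipschitz_fm : LipschitzOneOn fm U
  lipschitz_fp : LipschitzOneOn fp U
  lt : ∀ x ∈ U, fm x < fp x
  boundary : ∀ x ∈ frontier U, ∃ c : ℝ, Tendsto fm (𝓝[U] x) (𝓝 c) ∧ Tendsto fp (𝓝[U] x) (𝓝 c)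
  eq : Ω = {p | p.1 ∈ U ∧ fm p.1 < p.2 ∧ p.2 < fp p.1}

/-- The graph of `f` over `U`. -/
def graphOver (U : Set (Sphere n)) (f : Sphere n → ℝ) : Set (Ein n) := {p | p.1 ∈ U ∧ p.2 = f p.1}

/-- `X` is an `n`-dimensional topological manifold with boundary: Hausdorff, second countable, and
covered by charts with values in open subsets of a closed half-space of `ℝⁿ`. -/
def IsTopManifoldWithBoundary (n : ℕ) [NeZero n] (X : Type) [TopologicalSpace X] : Prop :=
  T2Space X ∧ SecondCountableTopology X ∧ Nonempty (ChartedSpace (EuclideanHalfSpace n) X)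

end EinsteinUniverse

end

open EinsteinUniverse

noncomputable section

namespace EinsteinUniverse

variable {n : ℕ}

/-! ### The round distance -/

/-! All the causality is carried by one inequality: `(y, s)` is in the causal future of `(x, t)`
exactly when `d(x, y) ≤ s - t`, and in the chronological future when this is strict. Causal
convexity makes the relations internal to `Ω` the restrictions of these (`chron_iff`, `causal_iff`),
so everything becomes metric geometry of the sphere.

Shape of `Ω`: two points whose times differ by `2π` or more have the conjugate of the earlier one
causally between them, so the vertical fibres of `Ω` are bounded. Convexity makes them intervals
with `1`-Lipschitz endpoints, and forbids a gap between the endpoints over the boundary of `U`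
(`CausallyConvex.exists_regionData`).

Ideal points: an indecomposable past set is directed, hence is the past of a single limit point,
lying in `Ω` or on the upper graph (`IsCausalChart.exists_eq_pastOf`). The limit cannot escape over
the boundary of `U`, where the two graphs meet, because it stays strictly above the lower one. This
bijection is continuous since each subbasic set becomes a strict inequality between continuous
functions, and open by compactness of causal futures and the Hausdorff property
(`IsCausalChart.homeoIP`). Working with an abstract chart lets time reversal give the future sets
from the same argument. The terminal sets are the points of the graphs, and gluing along `Ω` gives
the region with both graphs, homeomorphic to `U × [0,1]` (`completionHomeo`, `bandHomeo`).

Cauchy hypersurfaces: vertical lines are inextensible, so such a hypersurface is a graph over `U`,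
hence homeomorphic to `U`. One exists because a strictly `1`-Lipschitz function fits between the two
graphs (`IsRegionData.exists_strictly_short`). -/

lemma norm_coe_sphere (x : Sphere n) : ‖(x : EuclideanSpace ℝ (Fin n))‖ = 1 := by simp

lemma coe_sphere_ne_zero (x : Sphere n) : (x : EuclideanSpace ℝ (Fin n)) ≠ 0 := by
  intro h
  simpa [h] using norm_coe_sphere x

lemma sphereDist_comm (x y : Sphere n) : sphereDist x y = sphereDist y x :=
  InnerProductGeometry.angle_comm _ _

lemma sphereDist_triangle (x y z : Sphere n) :
    sphereDist x z ≤ sphereDist x y + sphereDist y z :=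
  InnerProductGeometry.angle_le_angle_add_angle _ _ _

@[simp] lemma sphereDist_self (x : Sphere n) : sphereDist x x = 0 :=
  InnerProductGeometry.angle_self (coe_sphere_ne_zero x)

lemma sphereDist_nonneg (x y : Sphere n) : 0 ≤ sphereDist x y :=
  InnerProductGeometry.angle_nonneg _ _

lemma sphereDist_neg_left (x y : Sphere n) : sphereDist (-x) y = Real.pi - sphereDist x y :=
  InnerProductGeometry.angle_neg_left _ _

lemma continuous_sphereDist : Continuous (fun p : Sphere n × Sphere n => sphereDist p.1 p.2) := by
  rw [continuous_iff_continuousAt]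
  intro p
  have h := InnerProductGeometry.continuousAt_angle
    (x := ((p.1 : EuclideanSpace ℝ (Fin n)), (p.2 : EuclideanSpace ℝ (Fin n))))
    (coe_sphere_ne_zero _) (coe_sphere_ne_zero _)
  have h2 : ContinuousAt (fun q : Sphere n × Sphere n =>
      ((q.1 : EuclideanSpace ℝ (Fin n)), (q.2 : EuclideanSpace ℝ (Fin n)))) p :=
    ((continuous_subtype_val.comp continuous_fst).prodMk
      (continuous_subtype_val.comp continuous_snd)).continuousAt
  exact ContinuousAt.comp (f := fun q : Sphere n × Sphere n =>
    ((q.1 : EuclideanSpace ℝ (Fin n)), (q.2 : EuclideanSpace ℝ (Fin n)))) h h2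

lemma continuous_sphereDist_comp {X : Type*} [TopologicalSpace X] {f g : X → Sphere n}
    (hf : Continuous f) (hg : Continuous g) : Continuous fun x => sphereDist (f x) (g x) := by
  have h : Continuous fun x => (f x, g x) := hf.prodMk hg
  have h' := continuous_sphereDist.comp h
  exact h'

lemma inner_coe_sphere (x y : Sphere n) :
    inner ℝ (x : EuclideanSpace ℝ (Fin n)) (y : EuclideanSpace ℝ (Fin n))
      = Real.cos (sphereDist x y) :=
  InnerProductGeometry.inner_eq_cos_angle_of_norm_eq_one (norm_coe_sphere x) (norm_coe_sphere y)

lemma dist_eq_two_mul_sin (x y : Sphere n) : dist x y = 2 * Real.sin (sphereDist x y / 2) := by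
  have h0 := sphereDist_nonneg x y
  have h1 : sphereDist x y ≤ Real.pi := InnerProductGeometry.angle_le_pi _ _
  have hs : 0 ≤ Real.sin (sphereDist x y / 2) :=
    Real.sin_nonneg_of_nonneg_of_le_pi (by linarith) (by linarith)
  rw [Subtype.dist_eq, dist_eq_norm]
  have : ‖(x : EuclideanSpace ℝ (Fin n)) - y‖ ^ 2 = (2 * Real.sin (sphereDist x y / 2)) ^ 2 := by
    rw [norm_sub_sq_real, inner_coe_sphere, norm_coe_sphere, norm_coe_sphere]
    have := Real.cos_sq' (sphereDist x y / 2)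
    have h2 := Real.cos_two_mul (sphereDist x y / 2)
    rw [mul_div_cancel₀ _ (two_ne_zero)] at h2
    nlinarith
  exact (sq_eq_sq₀ (norm_nonneg _) (by positivity)).1 this

/-- Jordan's inequality `sin u ≥ 2u/π`, with `π ≤ 4`. -/
lemma sphereDist_le_two_mul_dist (x y : Sphere n) : sphereDist x y ≤ 2 * dist x y := by
  have h0 := sphereDist_nonneg x y
  have h1 : sphereDist x y ≤ Real.pi := InnerProductGeometry.angle_le_pi _ _
  have h := Real.mul_le_sin (x := sphereDist x y / 2) (by linarith) (by linarith)
  rw [dist_eq_two_mul_sin]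
  have hp : (1:ℝ) / 2 ≤ 2 / Real.pi := by
    rw [div_le_div_iff₀ (by norm_num) Real.pi_pos]
    linarith [Real.pi_le_four]
  nlinarith

lemma dist_le_sphereDist (x y : Sphere n) : dist x y ≤ sphereDist x y := by
  rw [dist_eq_two_mul_sin]
  have := Real.sin_le (x := sphereDist x y / 2) (by linarith [sphereDist_nonneg x y])
  linarith

lemma sphereDist_eq_zero {x y : Sphere n} (h : sphereDist x y ≤ 0) : x = y :=
  dist_le_zero.1 ((dist_le_sphereDist x y).trans h)

/-- Short chords are almost as long as the arcs they subtend. -/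
lemma sphereDist_mul_le_dist (x y : Sphere n) :
    sphereDist x y * (1 - dist x y ^ 2) ≤ dist x y := by
  have h0 := sphereDist_nonneg x y
  have h1 := sphereDist_le_two_mul_dist x y
  rcases h0.eq_or_lt with h2 | h2
  · rw [← h2, zero_mul]; exact dist_nonneg
  -- For an arc `θ` the chord is `2 sin(θ/2) ≥ θ(1 - θ²/24)`, and `θ` is at most twice the chord.
  have h3 := Real.sin_gt_sub_cube (x := sphereDist x y / 2) (by linarith)
  have h4 := dist_eq_two_mul_sin x y
  have h5 : sphereDist x y * (1 - (sphereDist x y) ^ 2 / 24) ≤ dist x y := by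
    rw [h4]; nlinarith
  refine le_trans (mul_le_mul_of_nonneg_left ?_ h0) h5
  nlinarith

lemma tendsto_iff_sphereDist {ι : Type*} {l : Filter ι} {f : ι → Sphere n} {x : Sphere n} :
    Tendsto f l (𝓝 x) ↔ Tendsto (fun i => sphereDist (f i) x) l (𝓝 0) := by
  constructor
  · intro h
    have := (continuous_sphereDist.tendsto (x, x)).comp (h.prodMk_nhds tendsto_const_nhds)
    simpa [Function.comp_def] using this
  · intro h
    rw [tendsto_iff_dist_tendsto_zero]
    exact squeeze_zero (fun _ => dist_nonneg) (fun _ => dist_le_sphereDist _ _) h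

/-! ### Great circles -/

lemma exists_unit_orthogonal (hn : 2 ≤ n) (x : Sphere n) :
    ∃ e : EuclideanSpace ℝ (Fin n), ‖e‖ = 1 ∧ inner ℝ (x : EuclideanSpace ℝ (Fin n)) e = 0 := by
  obtain ⟨m, rfl⟩ : ∃ m, n = m + 1 := ⟨n - 1, by omega⟩
  have : Fact (Module.finrank ℝ (EuclideanSpace ℝ (Fin (m + 1))) = m + 1) := ⟨by simp⟩
  have h := Submodule.finrank_orthogonal_span_singleton (𝕜 := ℝ) (n := m) (coe_sphere_ne_zero x)
  have : 0 < Module.finrank ℝ (Submodule.span ℝ {(x : EuclideanSpace ℝ (Fin (m+1)))})ᗮ := by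
    rw [h]; omega
  have := Module.finrank_pos_iff.1 this
  obtain ⟨v, hv⟩ := exists_ne
    (0 : (Submodule.span ℝ {(x : EuclideanSpace ℝ (Fin (m+1)))})ᗮ)
  have hv0 : ‖(v : EuclideanSpace ℝ (Fin (m+1)))‖ ≠ 0 := by simpa using hv
  refine ⟨‖(v : EuclideanSpace ℝ (Fin (m+1)))‖⁻¹ • v, ?_, ?_⟩
  · rw [norm_smul, norm_inv, norm_norm, inv_mul_cancel₀ hv0]
  · rw [inner_smul_right, Submodule.mem_orthogonal_singleton_iff_inner_right.1 v.2, mul_zero]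

/-- `e` is the normalized component of `y` orthogonal to `x`. When `y = ±x` this component vanishes
and any unit vector orthogonal to `x` serves, which requires `n ≥ 2`. -/
lemma exists_great_circle (hn : 2 ≤ n) (x y : Sphere n) :
    ∃ e : EuclideanSpace ℝ (Fin n), ‖e‖ = 1 ∧ inner ℝ (x : EuclideanSpace ℝ (Fin n)) e = 0 ∧
      (y : EuclideanSpace ℝ (Fin n))
        = Real.cos (sphereDist x y) • (x : EuclideanSpace ℝ (Fin n))
          + Real.sin (sphereDist x y) • e := by
  set θ := sphereDist x y with hθ
  set w : EuclideanSpace ℝ (Fin n) := y - Real.cos θ • (x : EuclideanSpace ℝ (Fin n)) with hw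
  have hxx : inner ℝ (x : EuclideanSpace ℝ (Fin n)) (x : EuclideanSpace ℝ (Fin n)) = 1 := by
    rw [real_inner_self_eq_norm_sq, norm_coe_sphere]; norm_num
  have hxw : inner ℝ (x : EuclideanSpace ℝ (Fin n)) w = 0 := by
    rw [hw, inner_sub_right, inner_smul_right, hxx, inner_coe_sphere]; simp [hθ]
  have hs : 0 ≤ Real.sin θ :=
    Real.sin_nonneg_of_nonneg_of_le_pi (sphereDist_nonneg _ _) (InnerProductGeometry.angle_le_pi _ _)
  have hnw : ‖w‖ = Real.sin θ := by
    rw [← sq_eq_sq₀ (norm_nonneg _) hs, hw, norm_sub_sq_real, inner_smul_right, norm_smul,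
      real_inner_comm, inner_coe_sphere, norm_coe_sphere, norm_coe_sphere, ← hθ, Real.sin_sq,
      mul_one, Real.norm_eq_abs, sq_abs]
    ring
  by_cases h0 : ‖w‖ = 0
  · obtain ⟨e, he, hxe⟩ := exists_unit_orthogonal hn x
    refine ⟨e, he, hxe, ?_⟩
    rw [← hnw, h0, zero_smul, add_zero]
    exact sub_eq_zero.1 (norm_eq_zero.1 h0)
  · refine ⟨‖w‖⁻¹ • w, ?_, ?_, ?_⟩
    · rw [norm_smul, norm_inv, norm_norm, inv_mul_cancel₀ h0]
    · rw [inner_smul_right, hxw, mul_zero]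
    · rw [← hnw, smul_smul, mul_inv_cancel₀ h0, one_smul, hw]; abel

/-- Two points of the sphere are joined by a great circle of constant speed. -/
lemma exists_geodesic (hn : 2 ≤ n) (x y : Sphere n) :
    ∃ G : ℝ → Sphere n, G 0 = x ∧ G 1 = y ∧
      ∀ u, ∃ v, ‖v‖ = sphereDist x y ∧
        HasDerivAt (fun u => (G u : EuclideanSpace ℝ (Fin n))) v u := by
  obtain ⟨e, he, hxe, hy⟩ := exists_great_circle hn x y
  set θ := sphereDist x y
  have key : ∀ a b : ℝ, ‖a • (x : EuclideanSpace ℝ (Fin n)) + b • e‖ ^ 2 = a ^ 2 + b ^ 2 := by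
    intro a b
    rw [norm_add_sq_real, inner_smul_left, inner_smul_right, hxe, norm_smul, norm_smul, he,
      norm_coe_sphere, Real.norm_eq_abs, Real.norm_eq_abs, mul_one, mul_one, sq_abs, sq_abs]
    simp
  refine ⟨fun u => ⟨Real.cos (θ * u) • (x : EuclideanSpace ℝ (Fin n)) + Real.sin (θ * u) • e, ?_⟩,
    ?_, ?_, ?_⟩
  · rw [mem_sphere_zero_iff_norm, ← sq_eq_sq₀ (norm_nonneg _) zero_le_one, key]
    simp
  · ext1; simp
  · ext1; simp [hy]
  · intro u
    refine ⟨(-Real.sin (θ * u) * θ) • (x : EuclideanSpace ℝ (Fin n)) + (Real.cos (θ * u) * θ) • e,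
      ?_, ?_⟩
    · rw [← sq_eq_sq₀ (norm_nonneg _) (sphereDist_nonneg _ _), key]
      have := Real.sin_sq_add_cos_sq (θ * u)
      change _ = θ ^ 2
      linear_combination θ ^ 2 * this
    · have h : HasDerivAt (fun u => θ * u) θ u := by simpa using (hasDerivAt_id u).const_mul θ
      exact (h.cos.smul_const _).add (h.sin.smul_const _)

/-! ### Causal curves and the round distance -/

/-- A continuous function with non-positive lower right derivative off a finite set decreases. -/
lemma image_le_of_liminf_slope_of_finite {f : ℝ → ℝ} {B : Set ℝ} (hB : B.Finite) :
    ∀ {a b : ℝ}, a ≤ b → ContinuousOn f (Icc a b) →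
      (∀ s ∈ Ico a b \ B, ∀ r > 0, ∃ᶠ z in 𝓝[>] s, slope f s z < r) → f b ≤ f a := by
  induction B, hB using Set.Finite.induction_on with
  | empty =>
    intro a b hab hf h
    exact image_le_of_liminf_slope_right_le_deriv_boundary (B := fun _ => f a) (B' := fun _ => 0) hf
      le_rfl continuousOn_const (fun x _ => hasDerivWithinAt_const _ _ _)
      (fun x hx r hr => h x ⟨hx, id⟩ r hr) (right_mem_Icc.2 hab)
  | @insert c B _ _ ih =>
    intro a b hab hf h
    by_cases hc : c ∈ Ico a b
    · have h1 : f c ≤ f a := by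
        refine ih hc.1 (hf.mono (Icc_subset_Icc_right hc.2.le)) fun s hs r hr =>
          h s ⟨⟨hs.1.1, hs.1.2.trans hc.2⟩, ?_⟩ r hr
        rintro (rfl | h')
        · exact lt_irrefl _ hs.1.2
        · exact hs.2 h'
      -- The exceptional point `c` must stay out of the interval, so the induction hypothesis is
      -- applied from `c' > c` and continuity lets `c'` tend to `c`.
      have h2 : ∀ c' ∈ Ioc c b, f b ≤ f c' := by
        intro c' hc'
        refine ih hc'.2 (hf.mono (Icc_subset_Icc_left (hc.1.trans hc'.1.le))) fun s hs r hr =>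
          h s ⟨⟨(hc.1.trans hc'.1.le).trans hs.1.1, hs.1.2⟩, ?_⟩ r hr
        rintro (rfl | h')
        · exact (hc'.1.trans_le hs.1.1).ne rfl
        · exact hs.2 h'
      refine le_trans ?_ h1
      have h3 : Tendsto f (𝓝[Ioc c b] c) (𝓝 (f c)) :=
        (hf c ⟨hc.1, hc.2.le⟩).mono fun z hz => ⟨hc.1.trans hz.1.le, hz.2⟩
      have : (𝓝[Ioc c b] c).NeBot := by
        rw [nhdsWithin_Ioc_eq_nhdsGT hc.2]; infer_instance
      exact ge_of_tendsto h3 (eventually_mem_nhdsWithin.mono h2)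
    · refine ih hab hf fun s hs r hr => h s ⟨hs.1, ?_⟩ r hr
      rintro (rfl | h')
      · exact hc hs.1
      · exact hs.2 h'

section Slope

variable {γ : ℝ → Ein n} {s : ℝ} {w : EuclideanSpace ℝ (Fin n) × ℝ}

/-- The derivative is taken in Euclidean space and controls chords. `sphereDist_mul_le_dist` turns
them into arcs, with a factor tending to `1` at `s`. -/
lemma eventually_sphereDist_lt (h : HasDerivWithinAt (fun u => incl (γ u)) w (Ioi s) s) {r : ℝ}
    (hr : ‖w.1‖ < r) : ∀ᶠ z in 𝓝[>] s, sphereDist (γ s).1 (γ z).1 < r * (z - s) := by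
  have h1 : HasDerivWithinAt (fun u => ((γ u).1 : EuclideanSpace ℝ (Fin n))) w.1 (Ioi s) s :=
    (ContinuousLinearMap.fst ℝ (EuclideanSpace ℝ (Fin n)) ℝ).hasFDerivAt.comp_hasDerivWithinAt s h
  have h2 := (hasDerivWithinAt_iff_tendsto_slope' (by simp)).1 h1
  have h3 : Tendsto (fun z => dist (γ s).1 (γ z).1) (𝓝[>] s) (𝓝 0) := by
    have := h1.continuousWithinAt.dist
      (continuousWithinAt_const (b := ((γ s).1 : EuclideanSpace ℝ (Fin n))))
    simpa [ContinuousWithinAt, dist_comm, Subtype.dist_eq] using this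
  have h4 : Tendsto (fun z => r * (1 - dist (γ s).1 (γ z).1 ^ 2)) (𝓝[>] s) (𝓝 r) := by
    simpa using ((h3.pow 2).const_sub 1).const_mul r
  filter_upwards [h2.norm.eventually_lt h4 hr, self_mem_nhdsWithin,
    h3.eventually_lt_const one_pos] with z hz hzs hd
  have hzs' : 0 < z - s := sub_pos.2 hzs
  rw [slope_def_module, norm_smul, norm_inv, Real.norm_of_nonneg hzs'.le, ← dist_eq_norm,
    dist_comm, ← Subtype.dist_eq, inv_mul_lt_iff₀ hzs'] at hz
  have h5 := sphereDist_mul_le_dist (γ s).1 (γ z).1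
  have h6 : 0 < 1 - dist (γ s).1 (γ z).1 ^ 2 := by
    nlinarith [dist_nonneg (x := (γ s).1) (y := (γ z).1)]
  refine lt_of_mul_lt_mul_right (h5.trans_lt ?_) h6.le
  linarith

lemma eventually_lt_time (h : HasDerivWithinAt (fun u => incl (γ u)) w (Ioi s) s) {r : ℝ}
    (hr : r < w.2) : ∀ᶠ z in 𝓝[>] s, r * (z - s) < (γ z).2 - (γ s).2 := by
  have h1 : HasDerivWithinAt (fun u => (γ u).2) w.2 (Ioi s) s :=
    (ContinuousLinearMap.snd ℝ (EuclideanSpace ℝ (Fin n)) ℝ).hasFDerivAt.comp_hasDerivWithinAt s h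
  have h2 := (hasDerivWithinAt_iff_tendsto_slope' (by simp)).1 h1
  filter_upwards [h2.eventually_const_lt hr, self_mem_nhdsWithin] with z hz hzs
  have hzs' : 0 < z - s := sub_pos.2 hzs
  rw [slope_def_field, lt_div_iff₀ hzs'] at hz
  exact hz

end Slope

lemma norm_le_of_mem_futureCausal {w : EuclideanSpace ℝ (Fin n) × ℝ} (hw : w ∈ futureCausal n) :
    ‖w.1‖ ≤ w.2 ∧ 0 < w.2 := by
  obtain ⟨h0, h1, h2⟩ := hw
  have h3 : ‖w.1‖ ≤ w.2 := by
    unfold lorentz at h1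
    exact (sq_le_sq₀ (norm_nonneg _) h2).1 (by linarith)
  refine ⟨h3, h2.lt_of_ne fun h => h0 ?_⟩
  rw [← h] at h3
  exact Prod.ext (norm_le_zero_iff.1 h3) h.symm

lemma norm_lt_of_mem_futureTimelike {w : EuclideanSpace ℝ (Fin n) × ℝ}
    (hw : w ∈ futureTimelike n) : ‖w.1‖ < w.2 := by
  obtain ⟨h1, h2⟩ := hw
  unfold lorentz at h1
  exact (sq_lt_sq₀ (norm_nonneg _) h2.le).1 (by linarith)

lemma futureTimelike_subset_futureCausal : futureTimelike n ⊆ futureCausal n := by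
  rintro w ⟨h1, h2⟩
  refine ⟨?_, h1.le, h2.le⟩
  rintro rfl
  exact lt_irrefl _ h2

lemma IsCurveDirectedBy.mono {C C' : Set (EuclideanSpace ℝ (Fin n) × ℝ)} {I J : Set ℝ}
    {γ : ℝ → Ein n} (h : IsCurveDirectedBy C I γ) (hC : C ⊆ C') (hJI : J ⊆ I)
    (hJ : J.OrdConnected) (hJ' : J.Nontrivial) : IsCurveDirectedBy C' J γ := by
  obtain ⟨_, _, hc, B, hB, h⟩ := h
  refine ⟨hJ, hJ', hc.mono hJI, B, fun a ha b hb => hB a (hJI ha) b (hJI hb), fun s hs => ?_⟩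
  obtain ⟨w, hw, hd⟩ := h s ⟨hJI hs.1, hs.2⟩
  exact ⟨w, hC hw, hd.mono hJI⟩

lemma nontrivial_Icc {a b : ℝ} (h : a < b) : (Icc a b).Nontrivial :=
  ⟨a, left_mem_Icc.2 h.le, b, right_mem_Icc.2 h.le, h.ne⟩

section Directed

variable {C : Set (EuclideanSpace ℝ (Fin n) × ℝ)} {a b : ℝ} {γ : ℝ → Ein n}

lemma IsCurveDirectedBy.hasDerivWithinAt_Ioi {B : Set ℝ}
    (h : ∀ s ∈ Icc a b \ B, ∃ w ∈ C, HasDerivWithinAt (fun u => incl (γ u)) w (Icc a b) s)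
    {s : ℝ} (hs : s ∈ Ico a b \ B) :
    ∃ w ∈ C, HasDerivWithinAt (fun u => incl (γ u)) w (Ioi s) s := by
  obtain ⟨w, hw, hd⟩ := h s ⟨Ico_subset_Icc_self hs.1, hs.2⟩
  exact ⟨w, hw, hd.mono_of_mem_nhdsWithin (Icc_mem_nhdsGT_of_mem hs.1)⟩

/-- By the triangle inequality, the distance from the starting point minus the time has right slopes
at most `‖w.1‖ - w.2 ≤ 0` in the limit, so it cannot increase. Slopes avoid differentiating the
distance, which fails to be smooth at the starting point and its antipode. -/
lemma IsCausalCurve.sphereDist_le (h : IsCausalCurve (Icc a b) γ) (hab : a ≤ b) :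
    sphereDist (γ a).1 (γ b).1 ≤ (γ b).2 - (γ a).2 := by
  obtain ⟨_, _, hc, B, hB, h⟩ := h
  have hB' := hB a (left_mem_Icc.2 hab) b (right_mem_Icc.2 hab)
  have hx : ContinuousOn (fun s => (γ s).1) (Icc a b) := continuous_fst.comp_continuousOn hc
  have ht : ContinuousOn (fun s => (γ s).2) (Icc a b) := continuous_snd.comp_continuousOn hc
  have hd : Continuous fun y : Sphere n => sphereDist (γ a).1 y :=
    continuous_sphereDist_comp continuous_const continuous_id
  have hf : ContinuousOn (fun s => sphereDist (γ a).1 (γ s).1 - (γ s).2) (Icc a b) :=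
    (hd.comp_continuousOn hx).sub ht
  have key := image_le_of_liminf_slope_of_finite hB' hab hf ?_
  · simp only [sphereDist_self] at key
    linarith
  rintro s ⟨hs, hsB⟩ r hr
  obtain ⟨w, hw, hd⟩ := IsCurveDirectedBy.hasDerivWithinAt_Ioi h (s := s)
    ⟨hs, fun h => hsB ⟨h, Ico_subset_Icc_self hs⟩⟩
  have hw' := norm_le_of_mem_futureCausal hw
  refine Eventually.frequently ?_
  filter_upwards [eventually_sphereDist_lt hd (r := ‖w.1‖ + r / 2) (by linarith),
    eventually_lt_time hd (r := w.2 - r / 2) (by linarith), self_mem_nhdsWithin] with z h1 h2 hz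
  have hzs : 0 < z - s := sub_pos.2 hz
  rw [slope_def_field, div_lt_iff₀ hzs]
  have := sphereDist_triangle (γ a).1 (γ s).1 (γ z).1
  nlinarith

lemma IsCurveDirectedBy.exists_nonbreak {B : Set ℝ} (hab : a < b) (hB : (B ∩ Icc a b).Finite) :
    ∃ s ∈ Ioo a b, s ∉ B := by
  by_contra! hcon
  exact (Ioo_infinite hab) (hB.subset fun s hs => ⟨hcon s hs, Ioo_subset_Icc_self hs⟩)

/-- Somewhere the increments of a curve are controlled by a tangent vector. -/
lemma IsCurveDirectedBy.exists_step (hab : a < b)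
    (h : IsCurveDirectedBy C (Icc a b) γ) :
    ∃ w ∈ C, ∀ r, ‖w.1‖ < r → ∀ r' < w.2, ∃ s ∈ Ioo a b, ∃ z ∈ Ioo s b,
      sphereDist (γ s).1 (γ z).1 < r * (z - s) ∧ r' * (z - s) < (γ z).2 - (γ s).2 := by
  obtain ⟨_, _, _, B, hB, h⟩ := h
  obtain ⟨s, hs, hsB⟩ := IsCurveDirectedBy.exists_nonbreak hab
    (hB a (left_mem_Icc.2 hab.le) b (right_mem_Icc.2 hab.le))
  obtain ⟨w, hw, hd⟩ := IsCurveDirectedBy.hasDerivWithinAt_Ioi h (s := s) ⟨⟨hs.1.le, hs.2⟩, hsB⟩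
  refine ⟨w, hw, fun r hr r' hr' => ⟨s, hs, ?_⟩⟩
  obtain ⟨z, h1, h2, h3⟩ := ((eventually_sphereDist_lt hd hr).and
    ((eventually_lt_time hd hr').and (Ioo_mem_nhdsGT hs.2))).exists
  exact ⟨z, h3, h1, h2⟩

lemma IsCausalCurve.subcurve (h : IsCausalCurve (Icc a b) γ) {s z : ℝ} (hs : a ≤ s) (hz : z ≤ b)
    (hsz : s < z) : IsCausalCurve (Icc s z) γ :=
  IsCurveDirectedBy.mono h Subset.rfl (Icc_subset_Icc hs hz) ordConnected_Icc (nontrivial_Icc hsz)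

/-- A single strict gain, provided by `exists_step`, is enough: before and after it the weak
estimate applies. The same holds for `IsTimelikeCurve.sphereDist_lt`. -/
lemma IsCausalCurve.time_lt (h : IsCausalCurve (Icc a b) γ) (hab : a < b) :
    (γ a).2 < (γ b).2 := by
  obtain ⟨w, hw, hstep⟩ := IsCurveDirectedBy.exists_step hab h
  obtain ⟨s, hs, z, hz, -, h2⟩ :=
    hstep (‖w.1‖ + 1) (by linarith) 0 (norm_le_of_mem_futureCausal hw).2
  have h3 := (h.subcurve le_rfl hs.2.le hs.1).sphereDist_le hs.1.le
  have h4 := (h.subcurve (hs.1.trans hz.1).le le_rfl hz.2).sphereDist_le hz.2.le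
  have h5 := sphereDist_nonneg (γ a).1 (γ s).1
  have h6 := sphereDist_nonneg (γ z).1 (γ b).1
  linarith

lemma IsTimelikeCurve.isCausalCurve {I : Set ℝ} (h : IsTimelikeCurve I γ) : IsCausalCurve I γ :=
  IsCurveDirectedBy.mono h futureTimelike_subset_futureCausal Subset.rfl h.1 h.2.1

lemma IsTimelikeCurve.sphereDist_lt (h : IsTimelikeCurve (Icc a b) γ) (hab : a < b) :
    sphereDist (γ a).1 (γ b).1 < (γ b).2 - (γ a).2 := by
  have hc := h.isCausalCurve
  obtain ⟨w, hw, hstep⟩ := IsCurveDirectedBy.exists_step hab h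
  obtain ⟨r, hr, hr'⟩ := exists_between (norm_lt_of_mem_futureTimelike hw)
  obtain ⟨s, hs, z, hz, h1, h2⟩ := hstep r hr r hr'
  have h3 := (hc.subcurve le_rfl hs.2.le hs.1).sphereDist_le hs.1.le
  have h4 := (hc.subcurve (hs.1.trans hz.1).le le_rfl hz.2).sphereDist_le hz.2.le
  have h5 := sphereDist_triangle (γ a).1 (γ s).1 (γ b).1
  have h6 := sphereDist_triangle (γ s).1 (γ z).1 (γ b).1
  linarith

end Directed

lemma IsCausalCurve.sphereDist_le_of_mem {I : Set ℝ} {γ : ℝ → Ein n} (h : IsCausalCurve I γ)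
    {s z : ℝ} (hs : s ∈ I) (hz : z ∈ I) (hsz : s < z) :
    sphereDist (γ s).1 (γ z).1 ≤ (γ z).2 - (γ s).2 ∧ (γ s).2 < (γ z).2 := by
  have : IsCausalCurve (Icc s z) γ :=
    IsCurveDirectedBy.mono h Subset.rfl (h.1.out hs hz) ordConnected_Icc (nontrivial_Icc hsz)
  exact ⟨this.sphereDist_le hsz.le, this.time_lt hsz⟩

/-! ### Curves parametrized by time -/

/-- `c` is a continuous curve on the sphere, of speed at most `k` off a finite set. -/
def IsSlowPath (k : ℝ) (c : ℝ → Sphere n) : Prop :=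
  Continuous c ∧ ∃ B : Set ℝ, B.Finite ∧ ∀ s ∉ B, ∃ v, ‖v‖ ≤ k ∧
    HasDerivAt (fun u => (c u : EuclideanSpace ℝ (Fin n))) v s

lemma isSlowPath_const (x : Sphere n) {k : ℝ} (hk : 0 ≤ k) : IsSlowPath k fun _ => x :=
  ⟨continuous_const, ∅, finite_empty, fun s _ => ⟨0, by simpa using hk, hasDerivAt_const _ _⟩⟩

lemma IsSlowPath.glue {k : ℝ} {c₁ c₂ : ℝ → Sphere n} (h₁ : IsSlowPath k c₁) (h₂ : IsSlowPath k c₂)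
    {b : ℝ} (hb : c₁ b = c₂ b) : IsSlowPath k fun s => if s ≤ b then c₁ s else c₂ s := by
  obtain ⟨hc₁, B₁, hB₁, h₁⟩ := h₁
  obtain ⟨hc₂, B₂, hB₂, h₂⟩ := h₂
  refine ⟨hc₁.if_le hc₂ continuous_id continuous_const (by rintro s rfl; exact hb),
    insert b (B₁ ∪ B₂), (hB₁.union hB₂).insert b, fun s hs => ?_⟩
  simp only [mem_insert_iff, mem_union, not_or] at hs
  rcases lt_or_gt_of_ne hs.1 with hsb | hsb
  · obtain ⟨v, hv, hd⟩ := h₁ s hs.2.1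
    refine ⟨v, hv, hd.congr_of_eventuallyEq ?_⟩
    filter_upwards [Iio_mem_nhds hsb] with u hu
    rw [if_pos (le_of_lt hu)]
  · obtain ⟨v, hv, hd⟩ := h₂ s hs.2.2
    refine ⟨v, hv, hd.congr_of_eventuallyEq ?_⟩
    filter_upwards [Ioi_mem_nhds hsb] with u hu
    rw [if_neg (not_le_of_gt hu)]

lemma exists_isSlowPath (hn : 2 ≤ n) (x y : Sphere n) {a b : ℝ} (hab : a < b) :
    ∃ c : ℝ → Sphere n, IsSlowPath (sphereDist x y / (b - a)) c ∧ c a = x ∧ c b = y := by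
  obtain ⟨G, h0, h1, hG⟩ := exists_geodesic hn x y
  have hba : 0 < b - a := sub_pos.2 hab
  have hd : ∀ s, ∃ v, ‖v‖ ≤ sphereDist x y / (b - a) ∧
      HasDerivAt (fun u => (G ((u - a) / (b - a)) : EuclideanSpace ℝ (Fin n))) v s := by
    intro s
    obtain ⟨v, hv, hd⟩ := hG ((s - a) / (b - a))
    have h2 : HasDerivAt (fun u => (u - a) / (b - a)) (1 / (b - a)) s :=
      ((hasDerivAt_id s).sub_const a).div_const (b - a)
    have h3 := HasDerivAt.scomp (g₁ := fun u => (G u : EuclideanSpace ℝ (Fin n))) s hd h2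
    refine ⟨(1 / (b - a)) • v, ?_, h3⟩
    rw [norm_smul, hv, Real.norm_of_nonneg (by positivity)]
    exact (by ring : _ = _).le
  refine ⟨fun s => G ((s - a) / (b - a)), ⟨?_, ∅, finite_empty, fun s _ => hd s⟩, ?_, ?_⟩
  · rw [continuous_induced_rng, continuous_iff_continuousAt]
    intro s
    obtain ⟨v, -, h⟩ := hd s
    exact h.continuousAt
  · simp [h0]
  · simp [div_self hba.ne', h1]

lemma IsSlowPath.mono {k k' : ℝ} {c : ℝ → Sphere n} (h : IsSlowPath k c) (hk : k ≤ k') :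
    IsSlowPath k' c := by
  obtain ⟨hc, B, hB, h⟩ := h
  refine ⟨hc, B, hB, fun s hs => ?_⟩
  obtain ⟨v, hv, hd⟩ := h s hs
  exact ⟨v, hv.trans hk, hd⟩

lemma IsSlowPath.isCurveDirectedBy {k : ℝ} {c : ℝ → Sphere n} (h : IsSlowPath k c)
    {C : Set (EuclideanSpace ℝ (Fin n) × ℝ)}
    (hC : ∀ v : EuclideanSpace ℝ (Fin n), ‖v‖ ≤ k → (v, (1 : ℝ)) ∈ C) {I : Set ℝ}
    (hI : I.OrdConnected) (hI' : I.Nontrivial) : IsCurveDirectedBy C I fun s => (c s, s) := by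
  obtain ⟨hc, B, hB, h⟩ := h
  refine ⟨hI, hI', (hc.prodMk continuous_id).continuousOn, B,
    fun a _ b _ => hB.subset inter_subset_left, fun s hs => ?_⟩
  obtain ⟨v, hv, hd⟩ := h s hs.2
  exact ⟨(v, 1), hC v hv, (hd.prodMk (hasDerivAt_id s)).hasDerivWithinAt⟩

lemma IsSlowPath.isCausalCurve {c : ℝ → Sphere n} (h : IsSlowPath 1 c) {I : Set ℝ}
    (hI : I.OrdConnected) (hI' : I.Nontrivial) : IsCausalCurve I fun s => (c s, s) := by
  refine h.isCurveDirectedBy (C := futureCausal n) (fun v hv => ⟨fun h => ?_, ?_, zero_le_one⟩)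
    hI hI'
  · exact one_ne_zero (congrArg Prod.snd h)
  · have := norm_nonneg v
    simp only [lorentz]
    nlinarith

lemma IsSlowPath.isTimelikeCurve {k : ℝ} (hk : k < 1) {c : ℝ → Sphere n} (h : IsSlowPath k c)
    {I : Set ℝ} (hI : I.OrdConnected) (hI' : I.Nontrivial) :
    IsTimelikeCurve I fun s => (c s, s) := by
  refine h.isCurveDirectedBy (C := futureTimelike n) (fun v hv => ⟨?_, zero_lt_one⟩) hI hI'
  have := norm_nonneg v
  simp only [lorentz]
  nlinarith

/-- A causal path between two causally related points. -/
lemma exists_isSlowPath_of_sphereDist_le (hn : 2 ≤ n) {p q : Ein n} (hpq : p ≠ q)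
    (h : sphereDist p.1 q.1 ≤ q.2 - p.2) :
    p.2 < q.2 ∧ ∃ c : ℝ → Sphere n, IsSlowPath 1 c ∧ c p.2 = p.1 ∧ c q.2 = q.1 := by
  have h0 := sphereDist_nonneg p.1 q.1
  have hlt : p.2 < q.2 := by
    refine lt_of_le_of_ne (by linarith) fun heq => hpq (Prod.ext (sphereDist_eq_zero ?_) heq)
    linarith
  obtain ⟨c, hc, h1, h2⟩ := exists_isSlowPath hn p.1 q.1 hlt
  exact ⟨hlt, c, hc.mono ((div_le_one (sub_pos.2 hlt)).2 h), h1, h2⟩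

/-- The metric form of causal convexity: two great-circle arcs run at constant speed, glued at `r`,
form a causal curve from `p` to `q`. -/
lemma CausallyConvex.mem_of_between (hn : 2 ≤ n) {Ω : Set (Ein n)} (hΩ : CausallyConvex Ω)
    {p q r : Ein n} (hp : p ∈ Ω) (hq : q ∈ Ω) (hpr : sphereDist p.1 r.1 ≤ r.2 - p.2)
    (hrq : sphereDist r.1 q.1 ≤ q.2 - r.2) : r ∈ Ω := by
  by_cases h1 : p = r
  · exact h1 ▸ hp
  by_cases h2 : r = q
  · exact h2 ▸ hq
  obtain ⟨h3, c₁, hc₁, h4, h5⟩ := exists_isSlowPath_of_sphereDist_le hn h1 hpr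
  obtain ⟨h6, c₂, hc₂, h7, h8⟩ := exists_isSlowPath_of_sphereDist_le hn h2 hrq
  have hc := hc₁.glue hc₂ (h5.trans h7.symm)
  have := hΩ p.2 q.2 _ (h3.trans h6)
    (hc.isCausalCurve ordConnected_Icc (nontrivial_Icc (h3.trans h6)))
    (by simpa only [if_pos h3.le, h4] using hp)
    (by simpa only [if_neg (not_le_of_gt h6), h8] using hq) r.2 ⟨h3.le, h6.le⟩
  simpa only [if_pos le_rfl, h5] using this

/-! ### The causal relations of the region as metric inequalities -/

section Causality

variable {Ω : Set (Ein n)}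

/-- For the converse, the great-circle curve joining the two points is timelike in the whole
universe, and causal convexity keeps it in `Ω`. -/
lemma chron_iff (hn : 2 ≤ n) (hΩ : CausallyConvex Ω) (p q : Ω) :
    Chron Ω p q ↔ sphereDist p.1.1 q.1.1 < q.1.2 - p.1.2 := by
  constructor
  · rintro ⟨a, b, γ, hab, hγ, -, hp, hq⟩
    have := hγ.sphereDist_lt hab
    rwa [hp, hq] at this
  · intro h
    have hlt : p.1.2 < q.1.2 := by linarith [sphereDist_nonneg p.1.1 q.1.1]
    obtain ⟨c, hc, h1, h2⟩ := exists_isSlowPath hn p.1.1 q.1.1 hlt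
    have hγ : IsTimelikeCurve (Icc p.1.2 q.1.2) fun s => (c s, s) :=
      hc.isTimelikeCurve ((div_lt_one (sub_pos.2 hlt)).2 h) ordConnected_Icc (nontrivial_Icc hlt)
    refine ⟨p.1.2, q.1.2, _, hlt, hγ, ?_, by simp [h1], by simp [h2]⟩
    exact hΩ _ _ _ hlt hγ.isCausalCurve (by simp [h1]) (by simp [h2])

lemma causal_iff (hn : 2 ≤ n) (hΩ : CausallyConvex Ω) (p q : Ω) :
    Causal Ω p q ↔ sphereDist p.1.1 q.1.1 ≤ q.1.2 - p.1.2 := by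
  constructor
  · rintro (rfl | ⟨a, b, γ, hab, hγ, -, hp, hq⟩)
    · simp
    · have := hγ.sphereDist_le hab.le
      rwa [hp, hq] at this
  · intro h
    by_cases hpq : p = q
    · exact Or.inl hpq
    obtain ⟨hlt, c, hc, h1, h2⟩ :=
      exists_isSlowPath_of_sphereDist_le hn (fun h => hpq (Subtype.ext h)) h
    have hγ : IsCausalCurve (Icc p.1.2 q.1.2) fun s => (c s, s) :=
      hc.isCausalCurve ordConnected_Icc (nontrivial_Icc hlt)
    refine Or.inr ⟨p.1.2, q.1.2, _, hlt, hγ, ?_, by simp [h1], by simp [h2]⟩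
    exact hΩ _ _ _ hlt hγ (by simp [h1]) (by simp [h2])

end Causality

/-! ### Regions between globally defined functions -/

/-- Globally defined `1`-Lipschitz functions. -/
def IsShort (f : Sphere n → ℝ) : Prop := ∀ x y, f x - f y ≤ sphereDist x y

lemma IsShort.continuous {f : Sphere n → ℝ} (h : IsShort f) : Continuous f := by
  rw [continuous_iff_continuousAt]
  intro x
  have hx : Tendsto (fun y => sphereDist y x) (𝓝 x) (𝓝 0) := tendsto_iff_sphereDist.1 tendsto_id
  rw [ContinuousAt, tendsto_iff_dist_tendsto_zero]
  refine squeeze_zero (fun _ => dist_nonneg) (fun y => ?_) hx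
  rw [Real.dist_eq, abs_le]
  have := h x y
  have := h y x
  rw [sphereDist_comm x y] at *
  constructor <;> linarith

lemma IsShort.neg {f : Sphere n → ℝ} (h : IsShort f) : IsShort fun x => -f x := by
  intro x y
  have := h y x
  rw [sphereDist_comm] at this
  linarith

lemma LipschitzOneOn.exists_extension {f : Sphere n → ℝ} {U : Set (Sphere n)}
    (h : LipschitzOneOn f U) : ∃ g, IsShort g ∧ EqOn f g U := by
  -- The metric carried by the sphere is the chordal one, whereas the Lipschitz extension must be
  -- made for the round distance. Continuity is recovered by `IsShort.continuous`.
  let m : PseudoMetricSpace (Sphere n) :=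
    { dist := sphereDist
      dist_self := sphereDist_self
      dist_comm := sphereDist_comm
      dist_triangle := sphereDist_triangle }
  have h1 : @LipschitzOnWith _ _ m.toPseudoEMetricSpace _ 1 f U :=
    @LipschitzOnWith.of_dist_le_mul _ _ m _ 1 U f fun x hx y hy => by
      rw [Real.dist_eq, NNReal.coe_one, one_mul]
      exact h x hx y hy
  obtain ⟨g, hg, hfg⟩ := @LipschitzOnWith.extend_real _ m _ _ _ h1
  refine ⟨g, fun x y => ?_, hfg⟩
  have h2 := @LipschitzWith.dist_le_mul _ _ m _ 1 g hg x y
  rw [Real.dist_eq, NNReal.coe_one, one_mul] at h2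
  exact (le_abs_self _).trans h2

/-- The functions `fm < fp` on the open set `U` extend to `1`-Lipschitz functions which coincide on
the boundary of `U`. -/
structure IsRegionData (U : Set (Sphere n)) (fm fp : Sphere n → ℝ) : Prop where
  isOpen : IsOpen U
  short_fm : IsShort fm
  short_fp : IsShort fp
  lt : ∀ x ∈ U, fm x < fp x
  boundary : ∀ x ∈ frontier U, fm x = fp x

/-- The open region between the graphs of two functions. -/
def region (U : Set (Sphere n)) (fm fp : Sphere n → ℝ) : Set (Ein n) :=
  {p | p.1 ∈ U ∧ fm p.1 < p.2 ∧ p.2 < fp p.1}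

lemma region_congr {U : Set (Sphere n)} {fm fp gm gp : Sphere n → ℝ} (hm : EqOn fm gm U)
    (hp : EqOn fp gp U) : region U fm fp = region U gm gp := by
  ext p
  refine and_congr_right fun h => ?_
  rw [hm h, hp h]

lemma IsRegionBetween.exists_regionData {Ω : Set (Ein n)} {U : Set (Sphere n)}
    {fm fp : Sphere n → ℝ} (h : IsRegionBetween Ω U fm fp) :
    ∃ gm gp, IsRegionData U gm gp ∧ EqOn fm gm U ∧ EqOn fp gp U ∧ Ω = region U gm gp := by
  obtain ⟨gm, hgm, hm⟩ := h.lipschitz_fm.exists_extension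
  obtain ⟨gp, hgp, hp⟩ := h.lipschitz_fp.exists_extension
  refine ⟨gm, gp, ⟨h.isOpen, hgm, hgp, fun x hx => ?_, fun x hx => ?_⟩, hm, hp, ?_⟩
  · rw [← hm hx, ← hp hx]
    exact h.lt x hx
  · obtain ⟨c, hcm, hcp⟩ := h.boundary x hx
    have : (𝓝[U] x).NeBot := mem_closure_iff_nhdsWithin_neBot.1 (frontier_subset_closure hx)
    have h1 : Tendsto gm (𝓝[U] x) (𝓝 c) := hcm.congr' (eventually_mem_nhdsWithin.mono hm)
    have h2 : Tendsto gp (𝓝[U] x) (𝓝 c) := hcp.congr' (eventually_mem_nhdsWithin.mono hp)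
    rw [tendsto_nhds_unique (hgm.continuous.continuousAt.mono_left nhdsWithin_le_nhds) h1,
      tendsto_nhds_unique (hgp.continuous.continuousAt.mono_left nhdsWithin_le_nhds) h2]
  · rw [← region_congr hm hp]
    exact h.eq

lemma IsRegionData.isRegionBetween {U : Set (Sphere n)} {fm fp : Sphere n → ℝ}
    (h : IsRegionData U fm fp) : IsRegionBetween (region U fm fp) U fm fp := by
  have key : ∀ {f : Sphere n → ℝ}, IsShort f → LipschitzOneOn f U := fun hf x _ y _ => by
    have := hf y x
    rw [sphereDist_comm] at this
    exact abs_le.2 ⟨by linarith, hf x y⟩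
  refine ⟨h.isOpen, key h.short_fm, key h.short_fp, h.lt, fun x hx => ⟨fm x, ?_, ?_⟩, rfl⟩
  · exact h.short_fm.continuous.continuousAt.mono_left nhdsWithin_le_nhds
  · rw [h.boundary x hx]
    exact h.short_fp.continuous.continuousAt.mono_left nhdsWithin_le_nhds

/-! ### Causally convex open sets without conjugate points -/

/-- Both `d(x, -x) = π` and `d(-x, y) ≤ π`, so a delay of `2π` leaves room to pass through `sigma
p`. -/
lemma sub_lt_of_noConjugatePoints (hn : 2 ≤ n) {Ω : Set (Ein n)} (hconvex : CausallyConvex Ω)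
    (hconj : NoConjugatePoints Ω) {p q : Ein n} (hp : p ∈ Ω) (hq : q ∈ Ω) :
    q.2 - p.2 < 2 * Real.pi := by
  by_contra! hcon
  refine hconj p hp (sigma p) (hconvex.mem_of_between hn hp hq ?_ ?_) rfl
  · change sphereDist p.1 (-p.1) ≤ p.2 + Real.pi - p.2
    rw [sphereDist_comm, sphereDist_neg_left, sphereDist_self]
    linarith
  · change sphereDist (-p.1) q.1 ≤ q.2 - (p.2 + Real.pi)
    rw [sphereDist_neg_left]
    linarith [sphereDist_nonneg p.1 q.1]

/-- `U` is the projection of `Ω`, and the two functions extend the infimum and the supremum of the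
vertical fibres `T x`. -/
lemma CausallyConvex.exists_regionData (hn : 2 ≤ n) {Ω : Set (Ein n)} (hopen : IsOpen Ω)
    (hconvex : CausallyConvex Ω) (hconj : NoConjugatePoints Ω) :
    ∃ U fm fp, IsRegionData U fm fp ∧ Ω = region U fm fp := by
  have hcv : ∀ {x y t r s}, (x, t) ∈ Ω → (x, s) ∈ Ω → sphereDist x y ≤ r - t →
      sphereDist x y ≤ s - r → (y, r) ∈ Ω := fun {x y t r s} h1 h2 h3 h4 =>
    hconvex.mem_of_between hn (r := (y, r)) h1 h2 h3 (by rwa [sphereDist_comm] at h4)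
  let T : Sphere n → Set ℝ := fun x => {t | (x, t) ∈ Ω}
  let U : Set (Sphere n) := {x | (T x).Nonempty}
  have hA : ∀ x, BddAbove (T x) := by
    intro x
    rcases (T x).eq_empty_or_nonempty with h | ⟨t, ht⟩
    · rw [h]; exact bddAbove_empty
    · refine ⟨t + 2 * Real.pi, fun s hs => ?_⟩
      have := sub_lt_of_noConjugatePoints hn hconvex hconj ht hs
      simp only at this
      linarith
  have hB : ∀ x, BddBelow (T x) := by
    intro x
    rcases (T x).eq_empty_or_nonempty with h | ⟨t, ht⟩
    · rw [h]; exact bddBelow_empty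
    · refine ⟨t - 2 * Real.pi, fun s hs => ?_⟩
      have := sub_lt_of_noConjugatePoints hn hconvex hconj hs ht
      simp only at this
      linarith
  have hp : ∀ x ∈ U, ∀ y ∈ U, sSup (T x) - sSup (T y) ≤ sphereDist x y := by
    intro x hx y hy
    rw [sub_le_iff_le_add]
    refine csSup_le hx fun t ht => ?_
    obtain ⟨s, hs⟩ := hy
    -- If `s` is lower than this, the point over `y` at height `t - d(x, y)` is causally between
    -- `(y, s)` and `(x, t)`, hence in `Ω`.
    by_cases hst : t - sphereDist x y ≤ s
    · linarith [le_csSup (hA y) hs]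
    · have : t - sphereDist x y ∈ T y := by
        refine hconvex.mem_of_between hn (r := (y, t - sphereDist x y)) hs ht ?_ ?_
        · simp only [sphereDist_self]; linarith
        · simp only [sphereDist_comm y x]; linarith
      linarith [le_csSup (hA y) this]
  have hm : ∀ x ∈ U, ∀ y ∈ U, sInf (T x) - sInf (T y) ≤ sphereDist x y := by
    intro x hx y hy
    rw [sub_le_comm]
    refine le_csInf hy fun t ht => ?_
    obtain ⟨s, hs⟩ := hx
    by_cases hst : s ≤ t + sphereDist x y
    · linarith [csInf_le (hB x) hs]
    · have : t + sphereDist x y ∈ T x := by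
        refine hconvex.mem_of_between hn (r := (x, t + sphereDist x y)) ht hs ?_ ?_
        · simp only [sphereDist_comm y x]; linarith
        · simp only [sphereDist_self]; linarith
      linarith [csInf_le (hB x) this]
  have hlip : ∀ {f : Sphere n → ℝ}, (∀ x ∈ U, ∀ y ∈ U, f x - f y ≤ sphereDist x y) →
      LipschitzOneOn f U := fun h x hx y hy =>
    abs_le.2 ⟨by have := h y hy x hx; rw [sphereDist_comm] at this; linarith, h x hx y hy⟩
  obtain ⟨gp, hgp, hgp'⟩ := (hlip hp).exists_extension
  obtain ⟨gm, hgm, hgm'⟩ := (hlip hm).exists_extension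
  have hOo : ∀ x t, (x, t) ∈ Ω → ∃ ε > 0, (x, t - ε) ∈ Ω ∧ (x, t + ε) ∈ Ω := by
    intro x t h
    have hc : Continuous fun s : ℝ => (x, s) := by fun_prop
    obtain ⟨ε, hε, hsub⟩ := Metric.isOpen_iff.1 (hopen.preimage hc) t h
    refine ⟨ε / 2, by positivity, hsub ?_, hsub ?_⟩ <;>
    · rw [Metric.mem_ball, Real.dist_eq]
      simp only [sub_sub_cancel_left, add_sub_cancel_left, abs_neg, abs_of_pos (half_pos hε)]
      exact half_lt_self hε
  have heq : Ω = region U gm gp := by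
    ext ⟨x, t⟩
    constructor
    · intro h
      have hx : x ∈ U := ⟨t, h⟩
      obtain ⟨ε, hε, h1, h2⟩ := hOo x t h
      refine ⟨hx, ?_, ?_⟩
      · rw [← hgm' hx]
        exact (csInf_le (hB x) h1).trans_lt (by simpa using hε)
      · rw [← hgp' hx]
        exact lt_of_lt_of_le (by simpa using hε) (le_csSup (hA x) h2)
    · rintro ⟨hx, h1, h2⟩
      rw [← hgm' hx] at h1
      rw [← hgp' hx] at h2
      obtain ⟨t1, ht1, h1⟩ := exists_lt_of_csInf_lt hx h1
      obtain ⟨t2, ht2, h2⟩ := exists_lt_of_lt_csSup hx h2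
      refine hcv (x := x) ht1 ht2 ?_ ?_ <;> rw [sphereDist_self] <;> linarith
  have hlt : ∀ x ∈ U, gm x < gp x := by
    rintro x ⟨t, ht⟩
    have : (x, t) ∈ Ω := ht
    rw [heq] at this
    exact this.2.1.trans this.2.2
  have hUo : IsOpen U := by
    have : U = Prod.fst '' Ω := by
      ext x
      simp only [mem_image, Prod.exists, exists_and_right, exists_eq_right]
      rfl
    rw [this]
    exact isOpenMap_fst _ hopen
  refine ⟨U, gm, gp, ⟨hUo, hgm, hgp, hlt, fun x hx => ?_⟩, heq⟩
  have hne : (𝓝[U] x).NeBot := mem_closure_iff_nhdsWithin_neBot.1 (frontier_subset_closure hx)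
  have ht : ∀ {f : Sphere n → ℝ}, Continuous f → Tendsto f (𝓝[U] x) (𝓝 (f x)) := fun hf =>
    hf.continuousAt.mono_left nhdsWithin_le_nhds
  have hle : gm x ≤ gp x := le_of_tendsto_of_tendsto (ht hgm.continuous) (ht hgp.continuous)
    (eventually_mem_nhdsWithin.mono fun y hy => (hlt y hy).le)
  -- A point `(x, t)` strictly between the two values is causally between `(y, t - d(y, x))` and
  -- `(y, t + d(y, x))`. For `y` in `U` close to `x` these lie in `Ω`, which forces `x` into the
  -- open set `U`.
  by_contra hne'
  have hxlt : gm x < gp x := lt_of_le_of_ne hle hne'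
  obtain ⟨t, ht1, ht2⟩ := exists_between hxlt
  have hd : Continuous fun y => sphereDist y x :=
    continuous_sphereDist_comp continuous_id continuous_const
  have h1 := (ht (hgm.continuous.add hd)).eventually_lt_const (u := t) (by simpa using ht1)
  have h2 := (ht (hgp.continuous.sub hd)).eventually_const_lt (u := t) (by simpa using ht2)
  obtain ⟨y, hy1, hy2, hy⟩ := (h1.and (h2.and eventually_mem_nhdsWithin)).exists
  have hd0 := sphereDist_nonneg y x
  simp only [Pi.add_apply, Pi.sub_apply] at hy1 hy2
  have hxt : (x, t) ∈ Ω := by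
    refine hcv (x := y) (t := t - sphereDist y x) (s := t + sphereDist y x) ?_ ?_
      (by linarith) (by linarith)
    · rw [heq]
      exact ⟨hy, by simp only; linarith, by simp only; linarith⟩
    · rw [heq]
      exact ⟨hy, by simp only; linarith, by simp only; linarith⟩
  rw [hUo.frontier_eq] at hx
  exact hx.2 ⟨t, hxt⟩

/-! ### Ideal points of a region -/

/-- The region between two graphs together with its upper boundary. -/
def upper (U : Set (Sphere n)) (fm fp : Sphere n → ℝ) : Set (Ein n) :=
  {p | p.1 ∈ U ∧ fm p.1 < p.2 ∧ p.2 ≤ fp p.1}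

lemma region_subset_upper {U : Set (Sphere n)} {fm fp : Sphere n → ℝ} :
    region U fm fp ⊆ upper U fm fp := fun _ h => ⟨h.1, h.2.1, h.2.2.le⟩

lemma IsShort.lt_of_sphereDist_le {f : Sphere n → ℝ} (hf : IsShort f) {p z : Ein n}
    (hp : f p.1 < p.2) (h : sphereDist p.1 z.1 ≤ z.2 - p.2) : f z.1 < z.2 := by
  have := hf z.1 p.1
  rw [sphereDist_comm] at this
  linarith

/-- Limits of points of the region in the future of one of its points are not on the lower
boundary. -/
lemma IsRegionData.mem_upper {U : Set (Sphere n)} {fm fp : Sphere n → ℝ}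
    (h : IsRegionData U fm fp) {p z : Ein n} (hp : fm p.1 < p.2)
    (hpz : sphereDist p.1 z.1 ≤ z.2 - p.2) (hz : z.1 ∈ closure U) (hz' : z.2 ≤ fp z.1) :
    z ∈ upper U fm fp := by
  have h1 := h.short_fm.lt_of_sphereDist_le hp hpz
  refine ⟨?_, h1, hz'⟩
  -- Over the boundary of `U` the two functions agree, so no point is strictly above one graph and
  -- not above the other.
  by_contra hU
  have := h.boundary z.1 (h.isOpen.frontier_eq ▸ ⟨hz, hU⟩)
  linarith

lemma eq_of_sphereDist_le {z z' : Ein n}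
    (h1 : sphereDist z.1 z'.1 ≤ z'.2 - z.2) (h2 : sphereDist z'.1 z.1 ≤ z.2 - z'.2) : z = z' := by
  have h3 := sphereDist_nonneg z.1 z'.1
  have h4 := sphereDist_nonneg z'.1 z.1
  exact Prod.ext (sphereDist_eq_zero (by linarith)) (by linarith)

/-- An identification of `M` with a region, under which the chronological and causal relations of
`M` become those of the Einstein universe. -/
structure IsCausalChart {M : Type*} [TopologicalSpace M] (chron causal : M → M → Prop)
    (U : Set (Sphere n)) (fm fp : Sphere n → ℝ) (j : M → Ein n) : Prop where
  data : IsRegionData U fm fp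
  embedding : IsEmbedding j
  range_eq : range j = region U fm fp
  chron_iff : ∀ p q, chron p q ↔ sphereDist (j p).1 (j q).1 < (j q).2 - (j p).2
  causal_iff : ∀ p q, causal p q ↔ sphereDist (j p).1 (j q).1 ≤ (j q).2 - (j p).2

namespace IsCausalChart

variable {M : Type*} [TopologicalSpace M] {chron causal : M → M → Prop}
  {U : Set (Sphere n)} {fm fp : Sphere n → ℝ} {j : M → Ein n}

lemma mem_region (h : IsCausalChart chron causal U fm fp j) (p : M) : j p ∈ region U fm fp :=
  h.range_eq ▸ mem_range_self p

lemma exists_eq (h : IsCausalChart chron causal U fm fp j) {z : Ein n}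
    (hz : z ∈ region U fm fp) : ∃ p, j p = z := by
  rwa [← h.range_eq] at hz

/-- The chronological past in `M` of a point of the Einstein universe. -/
def pastOf (j : M → Ein n) (z : Ein n) : Set M :=
  {p | sphereDist (j p).1 z.1 < z.2 - (j p).2}

lemma continuous_sphereDist_left (h : IsCausalChart chron causal U fm fp j) (x : Sphere n) :
    Continuous fun p => sphereDist (j p).1 x := by
  have := h.embedding.continuous
  exact continuous_sphereDist_comp (continuous_fst.comp this) continuous_const

lemma continuous_time (h : IsCausalChart chron causal U fm fp j) : Continuous fun p => (j p).2 :=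
  continuous_snd.comp h.embedding.continuous

lemma isOpen_pastOf (h : IsCausalChart chron causal U fm fp j) (z : Ein n) :
    IsOpen (pastOf j z) :=
  isOpen_lt (h.continuous_sphereDist_left z.1) (continuous_const.sub h.continuous_time)

lemma isPastSet_pastOf (h : IsCausalChart chron causal U fm fp j) (z : Ein n) :
    IsPastSet chron (pastOf j z) := by
  intro p q hq hpq
  rw [h.chron_iff] at hpq
  have := sphereDist_triangle (j p).1 (j q).1 z.1
  simp only [pastOf, mem_ofPred_eq] at *
  linarith

/-- Points of `M` just below a point of the upper boundary. -/
lemma exists_below (h : IsCausalChart chron causal U fm fp j) {z : Ein n}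
    (hz : z ∈ upper U fm fp) {ε : ℝ} (hε : 0 < ε) :
    ∃ p, ∃ δ > 0, δ < ε ∧ j p = (z.1, z.2 - δ) := by
  obtain ⟨h1, h2, h3⟩ := hz
  obtain ⟨δ, hδ, hδ'⟩ := exists_between (lt_min hε (sub_pos.2 h2))
  rw [lt_min_iff] at hδ'
  obtain ⟨p, hp⟩ := h.exists_eq (z := (z.1, z.2 - δ))
    ⟨h1, by simp only; linarith, by simp only; linarith⟩
  exact ⟨p, δ, hδ, hδ'.1, hp⟩

lemma exists_vertical (h : IsCausalChart chron causal U fm fp j) {O : Set M} (hO : IsOpen O)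
    {p : M} (hp : p ∈ O) : ∃ ε > 0, ∀ δ, |δ| < ε → ∃ q ∈ O, j q = ((j p).1, (j p).2 + δ) := by
  obtain ⟨O', hO', rfl⟩ := h.embedding.isOpen_iff.1 hO
  have hc : Continuous fun δ : ℝ => ((j p).1, (j p).2 + δ) := by fun_prop
  obtain ⟨ε, hε, hsub⟩ := Metric.isOpen_iff.1 (hO'.preimage hc) 0 (by simpa using hp)
  obtain ⟨h1, h2, h3⟩ := h.mem_region p
  refine ⟨min ε (min ((j p).2 - fm (j p).1) (fp (j p).1 - (j p).2)),
    lt_min hε (lt_min (sub_pos.2 h2) (sub_pos.2 h3)), fun δ hδ => ?_⟩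
  rw [lt_min_iff, lt_min_iff] at hδ
  have h4 := abs_lt.1 hδ.2.1
  have h5 := abs_lt.1 hδ.2.2
  obtain ⟨q, hq⟩ := h.exists_eq (z := ((j p).1, (j p).2 + δ))
    ⟨h1, by simp only; linarith, by simp only; linarith⟩
  refine ⟨q, ?_, hq⟩
  have : δ ∈ Metric.ball (0 : ℝ) ε := by simpa using hδ.1
  simpa only [mem_preimage, hq] using hsub this

lemma exists_mem_above (h : IsCausalChart chron causal U fm fp j) {O : Set M} (hO : IsOpen O)
    {p : M} (hp : p ∈ O) : ∃ q ∈ O, chron p q := by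
  obtain ⟨ε, hε, hε'⟩ := h.exists_vertical hO hp
  obtain ⟨q, hq, hjq⟩ := hε' (ε / 2) (by rw [abs_of_pos (half_pos hε)]; linarith)
  refine ⟨q, hq, ?_⟩
  rw [h.chron_iff, hjq]
  simpa using hε

lemma closure_pastOf (h : IsCausalChart chron causal U fm fp j) (z : Ein n) :
    closure (pastOf j z) = {p | sphereDist (j p).1 z.1 ≤ z.2 - (j p).2} := by
  apply Subset.antisymm
  · refine closure_minimal (fun p hp => ?_) ?_
    · simp only [pastOf, mem_ofPred_eq] at hp ⊢
      exact hp.le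
    exact isClosed_le (h.continuous_sphereDist_left z.1) (continuous_const.sub h.continuous_time)
  · intro p hp
    rw [mem_closure_iff]
    intro O hO hpO
    obtain ⟨ε, hε, hε'⟩ := h.exists_vertical hO hpO
    obtain ⟨q, hq, hjq⟩ := hε' (-(ε / 2)) (by rw [abs_neg, abs_of_pos (half_pos hε)]; linarith)
    refine ⟨q, hq, ?_⟩
    simp only [pastOf, mem_ofPred_eq, hjq] at hp ⊢
    linarith

/-- If the past of `z` were `V ∪ W` with `a` missing from `V` and `b` from `W`, a point just below
`z` would be in the future of both `a` and `b`. It lies in `V` or `W`, which would then contain `a`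
or `b` respectively. -/
lemma isIP_pastOf (h : IsCausalChart chron causal U fm fp j) {z : Ein n}
    (hz : z ∈ upper U fm fp) : IsIP chron (pastOf j z) := by
  refine ⟨?_, h.isOpen_pastOf z, h.isPastSet_pastOf z, fun V W _ hV _ hW hVW => ?_⟩
  · obtain ⟨p, δ, hδ, -, hp⟩ := h.exists_below hz one_pos
    exact ⟨p, by simpa [pastOf, hp] using hδ⟩
  · by_contra! hcon
    obtain ⟨a, ha, haV⟩ := exists_of_ssubset
      (ssubset_of_subset_of_ne (hVW ▸ subset_union_left) hcon.1.symm)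
    obtain ⟨b, hb, hbW⟩ := exists_of_ssubset
      (ssubset_of_subset_of_ne (hVW ▸ subset_union_right) hcon.2.symm)
    simp only [pastOf, mem_ofPred_eq] at ha hb
    obtain ⟨p, δ, hδ, hδ', hp⟩ := h.exists_below hz (lt_min (sub_pos.2 ha) (sub_pos.2 hb))
    rw [lt_min_iff] at hδ'
    have hpz : p ∈ pastOf j z := by simpa [pastOf, hp] using hδ
    have hap : chron a p := by
      rw [h.chron_iff, hp]; simp only; linarith [hδ'.1]
    have hbp : chron b p := by
      rw [h.chron_iff, hp]; simp only; linarith [hδ'.2]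
    rw [hVW] at hpz
    exact hpz.elim (fun hpV => haV (hV a p hpV hap)) fun hpW => hbW (hW b p hpW hbp)

lemma le_of_pastOf_subset (h : IsCausalChart chron causal U fm fp j) {z z' : Ein n}
    (hz : z ∈ upper U fm fp) (hzz' : pastOf j z ⊆ pastOf j z') :
    sphereDist z.1 z'.1 ≤ z'.2 - z.2 := by
  refine le_of_forall_pos_lt_add fun ε hε => ?_
  obtain ⟨p, δ, hδ, hδ', hp⟩ := h.exists_below hz hε
  have hpz : p ∈ pastOf j z := by simpa [pastOf, hp] using hδ
  have := hzz' hpz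
  simp only [pastOf, mem_ofPred_eq, hp] at this
  linarith

/-! ### Every indecomposable past set is the past of a point -/

/-- Indecomposable past sets are directed. -/
lemma exists_chron_of_isIP (h : IsCausalChart chron causal U fm fp j) {P : Set M}
    (hP : IsIP chron P) {a b : M} (ha : a ∈ P) (hb : b ∈ P) :
    ∃ r ∈ P, chron a r ∧ chron b r := by
  obtain ⟨-, hO, hpast, hind⟩ := hP
  have hopen : ∀ A : Set M, IsOpen {p | ∃ r ∈ A, chron p r} := by
    intro A
    have : {p | ∃ r ∈ A, chron p r} = ⋃ r ∈ A, pastOf j (j r) := by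
      ext p; simp [pastOf, h.chron_iff]
    rw [this]
    exact isOpen_biUnion fun r _ => h.isOpen_pastOf (j r)
  have htrans : ∀ p q r, chron p q → chron q r → chron p r := by
    intro p q r hpq hqr
    rw [h.chron_iff] at *
    have := sphereDist_triangle (j p).1 (j q).1 (j r).1
    linarith
  have hpastset : ∀ A : Set M, IsPastSet chron {p | ∃ r ∈ A, chron p r} := by
    rintro A p q ⟨r, hr, hqr⟩ hpq
    exact ⟨r, hr, htrans _ _ _ hpq hqr⟩
  -- `P` splits into the past of its points that follow `a` and the past of those that do not. The
  -- second part misses `a`, so `P` is the first part, and `b` belongs to it.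
  have hunion : P = {p | ∃ r ∈ P ∩ {r | chron a r}, chron p r} ∪
      {p | ∃ r ∈ P \ {r | chron a r}, chron p r} := by
    ext p
    constructor
    · intro hp
      obtain ⟨q, hq, hpq⟩ := h.exists_mem_above hO hp
      by_cases haq : chron a q
      · exact Or.inl ⟨q, ⟨hq, haq⟩, hpq⟩
      · exact Or.inr ⟨q, ⟨hq, haq⟩, hpq⟩
    · rintro (⟨r, hr, hpr⟩ | ⟨r, hr, hpr⟩) <;> exact hpast p r hr.1 hpr
  rcases hind _ _ (hopen _) (hpastset _) (hopen _) (hpastset _) hunion with h1 | h1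
  · rw [h1] at hb
    obtain ⟨r, hr, hbr⟩ := hb
    exact ⟨r, hr.1, hr.2, hbr⟩
  · have ha' := ha
    rw [h1] at ha'
    obtain ⟨r, hr, har⟩ := ha'
    exact absurd har hr.2

/-- The vertex is `(x, T)`, with `T` the supremum of the time on `P` and `x` a limit of positions of
points `u k` whose times tend to `T`. Any `q` in `P` has a common later point with `u k`, of time at
most `T`, so `d(q, u k)` is at most the sum of the two remaining times. In the limit `q` is causally
before `(x, T)`. -/
lemma exists_eq_pastOf (h : IsCausalChart chron causal U fm fp j) {P : Set M}
    (hP : IsIP chron P) : ∃ z ∈ upper U fm fp, pastOf j z = P := by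
  obtain ⟨C, hC⟩ := isCompact_univ.bddAbove_image h.data.short_fp.continuous.continuousOn
  have hne : ((fun p => (j p).2) '' P).Nonempty := hP.1.image _
  have hbdd : BddAbove ((fun p => (j p).2) '' P) := by
    refine ⟨C, ?_⟩
    rintro _ ⟨p, -, rfl⟩
    exact (h.mem_region p).2.2.le.trans (hC ⟨(j p).1, mem_univ _, rfl⟩)
  set T := sSup ((fun p => (j p).2) '' P)
  have hT : ∀ p ∈ P, (j p).2 ≤ T := fun p hp => le_csSup hbdd ⟨p, hp, rfl⟩
  have hseq : ∀ k : ℕ, ∃ p ∈ P, T - 1 / ((k : ℝ) + 1) < (j p).2 := by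
    intro k
    obtain ⟨_, ⟨p, hp, rfl⟩, hlt⟩ := exists_lt_of_lt_csSup hne
      (sub_lt_self T (Nat.one_div_pos_of_nat (n := k)))
    exact ⟨p, hp, hlt⟩
  choose u huP hu using hseq
  obtain ⟨x, -, φ, hφ, hx⟩ := isCompact_univ.tendsto_subseq
    (x := fun k => (j (u k)).1) fun _ => mem_univ _
  have ht : Tendsto (fun k => (j (u k)).2) atTop (𝓝 T) := by
    refine tendsto_of_tendsto_of_tendsto_of_le_of_le ?_ tendsto_const_nhds (fun k => (hu k).le)
      fun k => hT _ (huP k)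
    simpa using tendsto_const_nhds.sub (tendsto_one_div_add_atTop_nhds_zero_nat (𝕜 := ℝ))
  have ht' := ht.comp hφ.tendsto_atTop
  have hd : ∀ q : M, Tendsto (fun k => sphereDist (j q).1 (j (u (φ k))).1) atTop
      (𝓝 (sphereDist (j q).1 x)) := by
    intro q
    have : Continuous fun y : Sphere n => sphereDist (j q).1 y :=
      continuous_sphereDist_comp continuous_const continuous_id
    exact (this.tendsto x).comp hx
  have hle : ∀ q ∈ P, sphereDist (j q).1 x ≤ T - (j q).2 := by
    intro q hq
    have h1 : ∀ k, sphereDist (j q).1 (j (u (φ k))).1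
        ≤ (T - (j q).2) + (T - (j (u (φ k))).2) := by
      intro k
      obtain ⟨r, hr, h1, h2⟩ := h.exists_chron_of_isIP hP hq (huP (φ k))
      rw [h.chron_iff] at h1 h2
      have h3 := sphereDist_triangle (j q).1 (j r).1 (j (u (φ k))).1
      rw [sphereDist_comm (j r).1] at h3
      linarith [hT r hr]
    have h2 : Tendsto (fun k => (T - (j q).2) + (T - (j (u (φ k))).2)) atTop
        (𝓝 ((T - (j q).2) + (T - T))) := (ht'.const_sub T).const_add _
    rw [sub_self, add_zero] at h2
    exact le_of_tendsto_of_tendsto (hd q) h2 (Eventually.of_forall h1)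
  have hmem : ((x, T) : Ein n) ∈ upper U fm fp := by
    obtain ⟨q, hq⟩ := hP.1
    refine h.data.mem_upper (z := (x, T)) (h.mem_region q).2.1 (hle q hq) ?_ ?_
    · exact mem_closure_of_tendsto hx (Eventually.of_forall fun k => (h.mem_region _).1)
    · exact le_of_tendsto_of_tendsto ht' ((h.data.short_fp.continuous.tendsto x).comp hx)
        (Eventually.of_forall fun k => (h.mem_region _).2.2.le)
  refine ⟨(x, T), hmem, Subset.antisymm (fun q hq => ?_) fun q hq => ?_⟩
  · obtain ⟨k, hk⟩ := ((hd q).eventually_lt (ht'.sub_const _) hq).exists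
    exact hP.2.2.1 q _ (huP (φ k)) ((h.chron_iff _ _).2 hk)
  -- Openness of `P` upgrades the causal relation to a chronological one: it is applied to a point
  -- `r` of `P` after `q`.
  · obtain ⟨r, hr, hqr⟩ := h.exists_mem_above hP.2.1 hq
    rw [h.chron_iff] at hqr
    have h1 := hle r hr
    have h2 := sphereDist_triangle (j q).1 (j r).1 x
    simp only [pastOf, mem_ofPred_eq]
    linarith

/-! ### The four kinds of subbasic open sets -/

/-- Here and in the next three lemmas, membership in a subbasic open set becomes a strict inequality
between continuous functions of `z`. This gives the continuity of `toIP`. -/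
lemma inter_chron_nonempty_iff (h : IsCausalChart chron causal U fm fp j) {z : Ein n}
    (hz : z ∈ upper U fm fp) (p : M) :
    (pastOf j z ∩ {q | chron p q}).Nonempty ↔ sphereDist (j p).1 z.1 < z.2 - (j p).2 := by
  constructor
  · rintro ⟨q, hq, hpq⟩
    exact h.isPastSet_pastOf z p q hq hpq
  · intro hp
    obtain ⟨q, δ, hδ, hδ', hq⟩ := h.exists_below hz (sub_pos.2 hp)
    refine ⟨q, by simpa [pastOf, hq] using hδ, ?_⟩
    rw [mem_ofPred_eq, h.chron_iff, hq]
    simp only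
    linarith

lemma inter_compl_causal_nonempty_iff (h : IsCausalChart chron causal U fm fp j) {z : Ein n}
    (hz : z ∈ upper U fm fp) (p : M) :
    (pastOf j z ∩ {q | causal q p}ᶜ).Nonempty ↔ (j p).2 - z.2 < sphereDist z.1 (j p).1 := by
  constructor
  · rintro ⟨q, hq, hpq⟩
    by_contra! hcon
    refine hpq ((h.causal_iff _ _).2 ?_)
    have := sphereDist_triangle (j q).1 z.1 (j p).1
    simp only [pastOf, mem_ofPred_eq] at hq
    linarith
  · intro hp
    obtain ⟨q, δ, hδ, hδ', hq⟩ := h.exists_below hz (sub_pos.2 hp)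
    refine ⟨q, by simpa [pastOf, hq] using hδ, ?_⟩
    rw [mem_compl_iff, mem_ofPred_eq, h.causal_iff, hq]
    simp only
    linarith

lemma closure_subset_chron_iff (h : IsCausalChart chron causal U fm fp j) {z : Ein n}
    (hz : z ∈ upper U fm fp) (p : M) :
    closure (pastOf j z) ⊆ {q | chron q p} ↔ sphereDist z.1 (j p).1 < (j p).2 - z.2 := by
  rw [h.closure_pastOf]
  constructor
  · intro hsub
    rcases hz.2.2.lt_or_eq with hlt | heq
    · obtain ⟨q, hq⟩ := h.exists_eq (z := z) ⟨hz.1, hz.2.1, hlt⟩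
      have : chron q p := hsub (by simp [hq])
      rwa [h.chron_iff, hq] at this
    -- On the upper graph the inclusion is impossible: points just below `z` would put `p` in the
    -- causal future of `z`, and `fp` being `1`-Lipschitz, `p` would not be below its graph.
    · have hle : sphereDist z.1 (j p).1 ≤ (j p).2 - z.2 := by
        refine le_of_forall_pos_lt_add fun ε hε => ?_
        obtain ⟨q, δ, hδ, hδ', hq⟩ := h.exists_below hz hε
        have : chron q p := hsub (by simpa [hq] using hδ.le)
        rw [h.chron_iff, hq] at this
        simp only at this
        linarith
      have h1 := h.data.short_fp (j p).1 z.1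
      rw [sphereDist_comm] at h1
      linarith [(h.mem_region p).2.2]
  · intro hp q hq
    rw [mem_ofPred_eq] at hq
    rw [mem_ofPred_eq, h.chron_iff]
    have := sphereDist_triangle (j q).1 z.1 (j p).1
    linarith

lemma closure_subset_compl_causal_iff (h : IsCausalChart chron causal U fm fp j) (z : Ein n)
    (p : M) :
    closure (pastOf j z) ⊆ {q | causal p q}ᶜ ↔ z.2 - (j p).2 < sphereDist (j p).1 z.1 := by
  rw [h.closure_pastOf]
  constructor
  · intro hsub
    by_contra! hcon
    exact hsub (show p ∈ _ from hcon) ((h.causal_iff _ _).2 (by simp))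
  · intro hp q hq hpq
    rw [mem_ofPred_eq] at hq hpq
    rw [h.causal_iff] at hpq
    have := sphereDist_triangle (j p).1 (j q).1 z.1
    linarith

/-! ### The space of ideal points -/

/-- The bijection from a region and its upper boundary to the indecomposable past sets. -/
def toIP (h : IsCausalChart chron causal U fm fp j) (z : upper U fm fp) : IPSpace chron :=
  ⟨pastOf j z, h.isIP_pastOf z.2⟩

lemma bijective_toIP (h : IsCausalChart chron causal U fm fp j) :
    Function.Bijective h.toIP := by
  constructor
  · intro z z' hzz'
    have heq : pastOf j z.1 = pastOf j z'.1 := congrArg Subtype.val hzz'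
    exact Subtype.ext (eq_of_sphereDist_le (h.le_of_pastOf_subset z.2 heq.le)
      (h.le_of_pastOf_subset z'.2 heq.ge))
  · rintro ⟨P, hP⟩
    obtain ⟨z, hz, rfl⟩ := h.exists_eq_pastOf hP
    exact ⟨⟨z, hz⟩, rfl⟩

lemma continuous_toIP (h : IsCausalChart chron causal U fm fp j) :
    @Continuous _ _ _ (ipTopology chron causal) h.toIP := by
  have h1 : ∀ x : Sphere n, Continuous fun z : upper U fm fp => sphereDist x z.1.1 := fun x =>
    continuous_sphereDist_comp continuous_const (continuous_fst.comp continuous_subtype_val)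
  have h2 : ∀ x : Sphere n, Continuous fun z : upper U fm fp => sphereDist z.1.1 x := fun x =>
    continuous_sphereDist_comp (continuous_fst.comp continuous_subtype_val) continuous_const
  have h3 : Continuous fun z : upper U fm fp => z.1.2 :=
    continuous_snd.comp continuous_subtype_val
  refine continuous_generateFrom_iff.2 ?_
  rintro O ⟨p, rfl | rfl | rfl | rfl⟩
  · convert isOpen_lt (h1 (j p).1) (h3.sub (continuous_const (y := (j p).2))) using 1
    ext z
    exact h.inter_chron_nonempty_iff z.2 p
  · convert isOpen_lt ((continuous_const (y := (j p).2)).sub h3) (h2 (j p).1) using 1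
    ext z
    exact h.inter_compl_causal_nonempty_iff z.2 p
  · convert isOpen_lt (h2 (j p).1) ((continuous_const (y := (j p).2)).sub h3) using 1
    ext z
    exact h.closure_subset_chron_iff z.2 p
  · convert isOpen_lt (h3.sub (continuous_const (y := (j p).2))) (h1 (j p).1) using 1
    ext z
    exact h.closure_subset_compl_causal_iff z.1 p

lemma isOpen_inter_chron_nonempty (p : M) :
    @IsOpen _ (ipTopology chron causal)
      {P : IPSpace chron | (P.1 ∩ {q | chron p q}).Nonempty} :=
  TopologicalSpace.isOpen_generateFrom_of_mem ⟨p, Or.inl rfl⟩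

lemma isOpen_closure_subset_compl_causal (p : M) :
    @IsOpen _ (ipTopology chron causal)
      {P : IPSpace chron | closure P.1 ⊆ {q | causal p q}ᶜ} :=
  TopologicalSpace.isOpen_generateFrom_of_mem ⟨p, Or.inr (Or.inr (Or.inr rfl))⟩

/-- If `z'` is not in the causal future of `z`, neither is it in that of some `p` just below `z`.
The past sets meeting the chronological future of `p`, and those whose closure avoids its causal
future, then separate the two. Of two distinct points, at least one is not in the causal future of
the other. -/
lemma t2Space (h : IsCausalChart chron causal U fm fp j) :
    @T2Space _ (ipTopology chron causal) := by
  let := ipTopology chron causal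
  have key : ∀ z z' : upper U fm fp, ¬ sphereDist z.1.1 z'.1.1 ≤ z'.1.2 - z.1.2 →
      SeparatedNhds {h.toIP z} {h.toIP z'} := by
    intro z z' hzz'
    obtain ⟨p, δ, hδ, hδ', hp⟩ := h.exists_below z.2 (sub_pos.2 (not_le.1 hzz'))
    refine ⟨_, _, isOpen_inter_chron_nonempty p, isOpen_closure_subset_compl_causal p, ?_, ?_, ?_⟩
    · rw [singleton_subset_iff]
      refine (h.inter_chron_nonempty_iff z.2 p).2 ?_
      simpa [hp] using hδ
    · rw [singleton_subset_iff]
      refine (h.closure_subset_compl_causal_iff z'.1 p).2 ?_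
      rw [hp]
      simp only
      linarith
    · rw [disjoint_left]
      intro P hP hP'
      obtain ⟨w, rfl⟩ := h.bijective_toIP.2 P
      have h1 := (h.inter_chron_nonempty_iff w.2 p).1 hP
      have h2 := (h.closure_subset_compl_causal_iff w.1 p).1 hP'
      linarith
  refine t2Space_iff_disjoint_nhds.2 fun P P' hne => ?_
  obtain ⟨z, rfl⟩ := h.bijective_toIP.2 P
  obtain ⟨z', rfl⟩ := h.bijective_toIP.2 P'
  have : SeparatedNhds {h.toIP z} {h.toIP z'} := by
    by_cases h1 : sphereDist z.1.1 z'.1.1 ≤ z'.1.2 - z.1.2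
    · refine (key z' z fun h2 => hne ?_).symm
      rw [Subtype.ext (eq_of_sphereDist_le h1 h2)]
    · exact key z z' h1
  simpa [separatedNhds_iff_disjoint] using this

/-- The conditions defining `upper` are not closed, but in the causal future of `p` they follow from
closed ones by `mem_upper`: the set is closed and bounded in the Einstein universe. -/
lemma isCompact_future (h : IsCausalChart chron causal U fm fp j) (p : M) :
    IsCompact {z : upper U fm fp | sphereDist (j p).1 z.1.1 ≤ z.1.2 - (j p).2} := by
  obtain ⟨C, hC⟩ := isCompact_univ.bddAbove_image h.data.short_fp.continuous.continuousOn
  have h1 : Continuous fun z : Ein n => sphereDist (j p).1 z.1 :=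
    continuous_sphereDist_comp continuous_const continuous_fst
  rw [Subtype.isCompact_iff]
  have heq : Subtype.val '' {z : upper U fm fp | sphereDist (j p).1 z.1.1 ≤ z.1.2 - (j p).2} =
      (Prod.fst ⁻¹' closure U ∩ {z : Ein n | z.2 ≤ fp z.1}) ∩
        {z : Ein n | sphereDist (j p).1 z.1 ≤ z.2 - (j p).2} := by
    ext z
    constructor
    · rintro ⟨⟨z, hz⟩, hz', rfl⟩
      exact ⟨⟨subset_closure hz.1, hz.2.2⟩, hz'⟩
    · rintro ⟨⟨hz1, hz2⟩, hz3⟩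
      exact ⟨⟨z, h.data.mem_upper (h.mem_region p).2.1 hz3 hz1 hz2⟩, hz3, rfl⟩
  rw [heq]
  refine (isCompact_univ.prod (isCompact_Icc (a := (j p).2) (b := C))).of_isClosed_subset
    (((isClosed_closure.preimage continuous_fst).inter (isClosed_le continuous_snd
      (h.data.short_fp.continuous.comp continuous_fst))).inter
        (isClosed_le h1 (continuous_snd.sub continuous_const))) ?_
  rintro z ⟨⟨-, hz2⟩, hz3⟩
  rw [mem_ofPred_eq] at hz2 hz3
  exact ⟨mem_univ _, by linarith [sphereDist_nonneg (j p).1 z.1],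
    hz2.trans (hC ⟨z.1, mem_univ _, rfl⟩)⟩

/-- The past sets meeting the chronological future of `p` form a neighbourhood of the image of `z`,
contained in the image of a compact set. On a compact set, a continuous map to a Hausdorff space is
closed. -/
lemma isOpenMap_toIP (h : IsCausalChart chron causal U fm fp j) :
    @IsOpenMap _ _ _ (ipTopology chron causal) h.toIP := by
  let := ipTopology chron causal
  have := h.t2Space
  intro O hO
  rw [isOpen_iff_mem_nhds]
  rintro _ ⟨z, hz, rfl⟩
  obtain ⟨p, δ, hδ, -, hp⟩ := h.exists_below z.2 one_pos
  have hclosed : IsClosed (h.toIP '' ({z : upper U fm fp |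
      sphereDist (j p).1 z.1.1 ≤ z.1.2 - (j p).2} \ O)) :=
    (((h.isCompact_future p).diff hO).image h.continuous_toIP).isClosed
  have hopen := (isOpen_inter_chron_nonempty (causal := causal) p).sdiff hclosed
  refine mem_of_superset (hopen.mem_nhds ⟨?_, ?_⟩) ?_
  · refine (h.inter_chron_nonempty_iff z.2 p).2 ?_
    simpa [hp] using hδ
  · rintro ⟨w, hw, hwz⟩
    exact hw.2 (h.bijective_toIP.1 hwz ▸ hz)
  · rintro P ⟨hP, hP'⟩
    obtain ⟨w, rfl⟩ := h.bijective_toIP.2 P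
    have h1 := (h.inter_chron_nonempty_iff w.2 p).1 hP
    by_contra hcon
    exact hP' ⟨w, ⟨h1.le, fun hw => hcon ⟨w, hw, rfl⟩⟩, rfl⟩

/-- The space of indecomposable past sets is the region with its upper boundary. -/
def homeoIP (h : IsCausalChart chron causal U fm fp j) :
    @Homeomorph (upper U fm fp) (IPSpace chron) _ (ipTopology chron causal) :=
  letI := ipTopology chron causal
  (Equiv.ofBijective h.toIP h.bijective_toIP).toHomeomorphOfContinuousOpen h.continuous_toIP
    h.isOpenMap_toIP

end IsCausalChart

/-! ### Limits of causal curves -/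

/-- Causally increasing families in a region converge to points of the region or of its upper
boundary. -/
lemma IsRegionData.exists_tendsto {U : Set (Sphere n)} {fm fp : Sphere n → ℝ}
    (h : IsRegionData U fm fp) {ι : Type*} [LinearOrder ι] [Nonempty ι] {c : ι → Ein n}
    (hc : ∀ i, c i ∈ region U fm fp)
    (hmono : ∀ i k, i < k → sphereDist (c i).1 (c k).1 ≤ (c k).2 - (c i).2) :
    ∃ z ∈ upper U fm fp, Tendsto c atTop (𝓝 z) ∧
      ∀ i, sphereDist (c i).1 z.1 ≤ z.2 - (c i).2 := by
  obtain ⟨C, hC⟩ := isCompact_univ.bddAbove_image h.short_fp.continuous.continuousOn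
  have hle : ∀ i k, i ≤ k → sphereDist (c i).1 (c k).1 ≤ (c k).2 - (c i).2 := by
    intro i k hik
    rcases hik.eq_or_lt with rfl | hlt
    · simp
    · exact hmono i k hlt
  have htm : Monotone fun i => (c i).2 := fun i k hik => by
    have := hle i k hik
    have := sphereDist_nonneg (c i).1 (c k).1
    simp only
    linarith
  have hbdd : BddAbove (range fun i => (c i).2) := by
    refine ⟨C, ?_⟩
    rintro _ ⟨i, rfl⟩
    exact (hc i).2.2.le.trans (hC ⟨(c i).1, mem_univ _, rfl⟩)
  have ht := tendsto_atTop_ciSup htm hbdd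
  set T := ⨆ i, (c i).2
  have hT : ∀ i, (c i).2 ≤ T := fun i => le_ciSup hbdd i
  -- The index set is arbitrary, so the limit position is first found along an ultrafilter. The
  -- distance to it is then bounded by the remaining time `T - (c i).2`, which tends to `0` along
  -- `atTop`.
  obtain ⟨x, -, hx⟩ := isCompact_univ.ultrafilter_le_nhds
    ((Ultrafilter.of (atTop : Filter ι)).map fun i => (c i).1) (by simp)
  have hx' : Tendsto (fun i => (c i).1) (Ultrafilter.of (atTop : Filter ι)) (𝓝 x) := hx
  have hd : ∀ i, sphereDist (c i).1 x ≤ T - (c i).2 := by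
    intro i
    have hcont : Continuous fun y : Sphere n => sphereDist (c i).1 y :=
      continuous_sphereDist_comp continuous_const continuous_id
    refine le_of_tendsto ((hcont.tendsto x).comp hx') (Ultrafilter.of_le _ ?_)
    filter_upwards [eventually_ge_atTop i] with k hk
    exact (hle i k hk).trans (by linarith [hT k])
  have hx'' : Tendsto (fun i => (c i).1) atTop (𝓝 x) := by
    refine tendsto_iff_sphereDist.2 (squeeze_zero (fun _ => sphereDist_nonneg _ _) hd ?_)
    simpa using ht.const_sub T
  obtain ⟨i⟩ := ‹Nonempty ι›
  refine ⟨(x, T), h.mem_upper (z := (x, T)) (hc i).2.1 (hd i) ?_ ?_, hx''.prodMk_nhds ht, hd⟩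
  · exact mem_closure_of_tendsto hx'' (Eventually.of_forall fun i => (hc i).1)
  · exact le_of_tendsto_of_tendsto ht ((h.short_fp.continuous.tendsto x).comp hx'')
      (Eventually.of_forall fun i => (hc i).2.2.le)

lemma IsCausalChart.exists_setOf_chron_eq {M : Type*} [TopologicalSpace M]
    {chron causal : M → M → Prop} {U : Set (Sphere n)} {fm fp : Sphere n → ℝ} {j : M → Ein n}
    (h : IsCausalChart chron causal U fm fp j) {ι : Type*} [LinearOrder ι] [Nonempty ι]
    {u : ι → M} (hmono : ∀ i k, i < k →
      sphereDist (j (u i)).1 (j (u k)).1 ≤ (j (u k)).2 - (j (u i)).2) :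
    ∃ z ∈ upper U fm fp, Tendsto (fun i => j (u i)) atTop (𝓝 z) ∧
      {q | ∃ i, chron q (u i)} = pastOf j z := by
  obtain ⟨z, hz, ht, hle⟩ := h.data.exists_tendsto (fun i => h.mem_region (u i)) hmono
  refine ⟨z, hz, ht, Subset.antisymm ?_ fun q hq => ?_⟩
  · rintro q ⟨i, hi⟩
    rw [h.chron_iff] at hi
    have := sphereDist_triangle (j q).1 (j (u i)).1 z.1
    have := hle i
    simp only [pastOf, mem_ofPred_eq]
    linarith
  · have hc : Continuous fun y : Ein n => sphereDist (j q).1 y.1 :=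
      continuous_sphereDist_comp continuous_const continuous_fst
    obtain ⟨i, hi⟩ := (((hc.tendsto z).comp ht).eventually_lt
      (((continuous_snd.tendsto z).comp ht).sub_const (j q).2) hq).exists
    exact ⟨i, (h.chron_iff _ _).2 hi⟩

/-! ### The two charts of a region -/

/-- Reversal of time. -/
def timeReversal (n : ℕ) : Ein n ≃ₜ Ein n where
  toFun p := (p.1, -p.2)
  invFun p := (p.1, -p.2)
  left_inv p := by simp
  right_inv p := by simp
  continuous_toFun := by fun_prop
  continuous_invFun := by fun_prop

@[simp] lemma timeReversal_fst (p : Ein n) : (timeReversal n p).1 = p.1 := rfl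
@[simp] lemma timeReversal_snd (p : Ein n) : (timeReversal n p).2 = -p.2 := rfl

lemma IsRegionData.reverse {U : Set (Sphere n)} {fm fp : Sphere n → ℝ}
    (h : IsRegionData U fm fp) : IsRegionData U (fun x => -fp x) fun x => -fm x :=
  ⟨h.isOpen, h.short_fp.neg, h.short_fm.neg, fun x hx => neg_lt_neg (h.lt x hx),
    fun x hx => by rw [h.boundary x hx]⟩

section Charts

variable {U : Set (Sphere n)} {fm fp : Sphere n → ℝ} {Ω : Set (Ein n)}

lemma isCausalChart_coe (hn : 2 ≤ n) (hΩ : CausallyConvex Ω) (h : IsRegionData U fm fp)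
    (heq : Ω = region U fm fp) :
    IsCausalChart (Chron Ω) (Causal Ω) U fm fp Subtype.val :=
  ⟨h, IsEmbedding.subtypeVal, by rw [Subtype.range_coe, heq], chron_iff hn hΩ, causal_iff hn hΩ⟩

lemma isCausalChart_reverse (hn : 2 ≤ n) (hΩ : CausallyConvex Ω) (h : IsRegionData U fm fp)
    (heq : Ω = region U fm fp) :
    IsCausalChart (flip (Chron Ω)) (flip (Causal Ω)) U (fun x => -fp x) (fun x => -fm x)
      (fun p : Ω => timeReversal n p) := by
  refine ⟨h.reverse, (timeReversal n).isEmbedding.comp IsEmbedding.subtypeVal, ?_, ?_, ?_⟩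
  · ext z
    constructor
    · rintro ⟨⟨p, hp⟩, rfl⟩
      rw [heq] at hp
      exact ⟨hp.1, neg_lt_neg hp.2.2, neg_lt_neg hp.2.1⟩
    · rintro ⟨h1, h2, h3⟩
      refine ⟨⟨timeReversal n z, ?_⟩, (timeReversal n).left_inv z⟩
      rw [heq]
      exact ⟨h1, lt_neg.1 h3, neg_lt.1 h2⟩
  · intro p q
    rw [flip, chron_iff hn hΩ, sphereDist_comm]
    simp only [timeReversal_fst, timeReversal_snd, sub_neg_eq_add, neg_add_eq_sub]
  · intro p q
    rw [flip, causal_iff hn hΩ, sphereDist_comm]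
    simp only [timeReversal_fst, timeReversal_snd, sub_neg_eq_add, neg_add_eq_sub]

/-! ### Inextensible curves -/

lemma IsSlowPath.inextensible {c : ℝ → Sphere n} (hc : IsSlowPath 1 c) {a b : ℝ} (hab : a < b)
    (hΩ : ∀ s ∈ Ioo a b, (c s, s) ∈ Ω) (ha : (c a, a) ∉ Ω) (hb : (c b, b) ∉ Ω) :
    IsFutureInextensible Ω (Ioo a b) (fun s => (c s, s)) ∧
      IsPastInextensible Ω (Ioo a b) (fun s => (c s, s)) := by
  have hcurve : IsCausalCurve (Ioo a b) fun s => (c s, s) := by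
    obtain ⟨s, hs⟩ := exists_between hab
    obtain ⟨s', hs'⟩ := exists_between hs.2
    exact hc.isCausalCurve ordConnected_Ioo
      ⟨s, hs, s', ⟨hs.1.trans hs'.1, hs'.2⟩, hs'.1.ne⟩
  have hcont : Continuous fun s => (c s, s) := hc.1.prodMk continuous_id
  refine ⟨⟨hcurve, hΩ, fun p hp ht => hb ?_⟩, ⟨hcurve, hΩ, fun p hp ht => ha ?_⟩⟩
  · have ht' : Tendsto (fun s => (c s, s)) (𝓝[<] b) (𝓝 p) := by
      rw [← map_coe_Ioo_atTop hab]
      exact tendsto_map'_iff.2 ht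
    have : (c b, b) = p := tendsto_nhds_unique (hcont.continuousWithinAt (x := b) (s := Iio b)) ht'
    rwa [this]
  · have ht' : Tendsto (fun s => (c s, s)) (𝓝[>] a) (𝓝 p) := by
      rw [← map_coe_Ioo_atBot hab]
      exact tendsto_map'_iff.2 ht
    have : (c a, a) = p := tendsto_nhds_unique (hcont.continuousWithinAt (x := a) (s := Ioi a)) ht'
    rwa [this]

lemma vertical_inextensible (h : IsRegionData U fm fp) (heq : Ω = region U fm fp) {x : Sphere n}
    (hx : x ∈ U) : IsFutureInextensible Ω (Ioo (fm x) (fp x)) (fun s => (x, s)) ∧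
      IsPastInextensible Ω (Ioo (fm x) (fp x)) (fun s => (x, s)) := by
  refine (isSlowPath_const x zero_le_one).inextensible (h.lt x hx) (fun s hs => ?_) ?_ ?_ <;>
    rw [heq]
  · exact ⟨hx, hs.1, hs.2⟩
  · exact fun h => lt_irrefl _ h.2.1
  · exact fun h => lt_irrefl _ h.2.2

/-- Future-inextensible curves end on the upper boundary, and their pasts are those of their
limits. -/
lemma IsFutureInextensible.exists_tendsto (hn : 2 ≤ n) (hΩ : CausallyConvex Ω)
    (h : IsRegionData U fm fp) (heq : Ω = region U fm fp) {I : Set ℝ} {γ : ℝ → Ein n}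
    (hγ : IsFutureInextensible Ω I γ) :
    ∃ z, z.1 ∈ U ∧ z.2 = fp z.1 ∧ Tendsto (fun s : I => γ s) atTop (𝓝 z) ∧
      {q : Ω | ∃ r : Ω, (∃ s ∈ I, γ s = r) ∧ Chron Ω q r} =
        IsCausalChart.pastOf Subtype.val z := by
  obtain ⟨hc, hmem, hlim⟩ := hγ
  have : Nonempty I := hc.2.1.nonempty.to_subtype
  obtain ⟨z, hz, ht, hpast⟩ := (isCausalChart_coe hn hΩ h heq).exists_setOf_chron_eq
    (u := fun s : I => ⟨γ s, hmem s s.2⟩) fun i k hik => (hc.sphereDist_le_of_mem i.2 k.2 hik).1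
  refine ⟨z, hz.1, hz.2.2.eq_of_not_lt fun hlt => ?_, ht, ?_⟩
  · exact hlim z (heq ▸ ⟨hz.1, hz.2.1, hlt⟩) ht
  · rw [← hpast]
    ext q
    constructor
    · rintro ⟨r, ⟨s, hs, hr⟩, hqr⟩
      have : (⟨γ s, hmem s hs⟩ : Ω) = r := Subtype.ext hr
      exact ⟨⟨s, hs⟩, this ▸ hqr⟩
    · rintro ⟨s, hs⟩
      exact ⟨_, ⟨s, s.2, rfl⟩, hs⟩

lemma IsPastInextensible.exists_tendsto (hn : 2 ≤ n) (hΩ : CausallyConvex Ω)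
    (h : IsRegionData U fm fp) (heq : Ω = region U fm fp) {I : Set ℝ} {γ : ℝ → Ein n}
    (hγ : IsPastInextensible Ω I γ) :
    ∃ z, z.1 ∈ U ∧ z.2 = fm z.1 ∧ Tendsto (fun s : I => γ s) atBot (𝓝 z) ∧
      {q : Ω | ∃ r : Ω, (∃ s ∈ I, γ s = r) ∧ Chron Ω r q} =
        IsCausalChart.pastOf (fun p : Ω => timeReversal n p) (timeReversal n z) := by
  obtain ⟨hc, hmem, hlim⟩ := hγ
  -- Past limits are future limits for the dual order on the parameters and the reversed time.
  have : Nonempty Iᵒᵈ := hc.2.1.nonempty.to_subtype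
  obtain ⟨z, hz, ht, hpast⟩ := (isCausalChart_reverse hn hΩ h heq).exists_setOf_chron_eq
    (u := fun s : Iᵒᵈ => ⟨γ (OrderDual.ofDual s).1, hmem _ (OrderDual.ofDual s).2⟩) fun i k hik => by
      have := (hc.sphereDist_le_of_mem (OrderDual.ofDual k).2 (OrderDual.ofDual i).2 hik).1
      rw [sphereDist_comm] at this
      simp only [timeReversal_fst, timeReversal_snd]
      linarith
  have hrev : timeReversal n (timeReversal n z) = z := (timeReversal n).left_inv z
  have ht' : Tendsto (fun s : I => γ s) atBot (𝓝 (timeReversal n z)) := by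
    have := ((timeReversal n).continuous.tendsto z).comp ht
    refine Tendsto.congr (fun s => ?_) this
    exact (timeReversal n).left_inv _
  refine ⟨timeReversal n z, hz.1, ?_, ht', ?_⟩
  · have : z.2 = -fm z.1 := hz.2.2.eq_of_not_lt fun hlt => by
      refine hlim (timeReversal n z) ?_ ht'
      rw [heq]
      exact ⟨hz.1, lt_neg.1 hlt, neg_lt.1 hz.2.1⟩
    simp [this]
  · rw [hrev, ← hpast]
    ext q
    constructor
    · rintro ⟨r, ⟨s, hs, hr⟩, hqr⟩
      have : (⟨γ s, hmem s hs⟩ : Ω) = r := Subtype.ext hr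
      exact ⟨OrderDual.toDual ⟨s, hs⟩, this ▸ hqr⟩
    · rintro ⟨s, hs⟩
      exact ⟨_, ⟨(OrderDual.ofDual s).1, (OrderDual.ofDual s).2, rfl⟩, hs⟩

/-! ### The causal boundaries -/

/-- The homeomorphism with the indecomposable past sets. -/
def homeoIP (hn : 2 ≤ n) (hΩ : CausallyConvex Ω) (h : IsRegionData U fm fp)
    (heq : Ω = region U fm fp) : upper U fm fp ≃ₜ IP Ω :=
  (isCausalChart_coe hn hΩ h heq).homeoIP

/-- The homeomorphism with the indecomposable future sets. -/
def homeoIF (hn : 2 ≤ n) (hΩ : CausallyConvex Ω) (h : IsRegionData U fm fp)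
    (heq : Ω = region U fm fp) : upper U (fun x => -fp x) (fun x => -fm x) ≃ₜ IF Ω :=
  (isCausalChart_reverse hn hΩ h heq).homeoIP

lemma homeoIP_val (hn : 2 ≤ n) (hΩ : CausallyConvex Ω) (h : IsRegionData U fm fp)
    (heq : Ω = region U fm fp) (z : upper U fm fp) :
    (homeoIP hn hΩ h heq z).1 = IsCausalChart.pastOf Subtype.val z.1 := rfl

lemma homeoIF_val (hn : 2 ≤ n) (hΩ : CausallyConvex Ω) (h : IsRegionData U fm fp)
    (heq : Ω = region U fm fp) (z : upper U (fun x => -fp x) fun x => -fm x) :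
    (homeoIF hn hΩ h heq z).1 = IsCausalChart.pastOf (fun p : Ω => timeReversal n p) z.1 := rfl

/-- The vertical line below a point of the upper graph ends there. Conversely every
future-inextensible curve ends on the graph, and injectivity of `homeoIP` identifies `z` with its
endpoint. -/
lemma isTIP_homeoIP_iff (hn : 2 ≤ n) (hΩ : CausallyConvex Ω) (h : IsRegionData U fm fp)
    (heq : Ω = region U fm fp) (z : upper U fm fp) :
    z.1.2 = fp z.1.1 ↔ IsTIP Ω (homeoIP hn hΩ h heq z) := by
  constructor
  · intro hz
    have hv := (vertical_inextensible h heq z.2.1).1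
    refine ⟨_, _, hv, ?_⟩
    obtain ⟨z', -, -, ht, hpast⟩ := hv.exists_tendsto hn hΩ h heq
    rw [hpast, homeoIP_val]
    congr 1
    have ht' : Tendsto (fun s => (z.1.1, s)) (𝓝[<] (fp z.1.1)) (𝓝 z') := by
      rw [← map_coe_Ioo_atTop (h.lt _ z.2.1)]
      exact tendsto_map'_iff.2 ht
    have hcont : Continuous fun s : ℝ => (z.1.1, s) := by fun_prop
    rw [← tendsto_nhds_unique (hcont.continuousWithinAt (x := fp z.1.1) (s := Iio _)) ht', ← hz]
  · rintro ⟨I, γ, hγ, hP⟩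
    obtain ⟨z', h1, h2, -, hpast⟩ := hγ.exists_tendsto hn hΩ h heq
    have hz' : z' ∈ upper U fm fp := ⟨h1, h2 ▸ h.lt _ h1, h2.le⟩
    have : homeoIP hn hΩ h heq z = homeoIP hn hΩ h heq ⟨z', hz'⟩ :=
      Subtype.ext (hP.trans hpast)
    rw [(homeoIP hn hΩ h heq).injective this]
    exact h2

lemma isTIF_homeoIF_iff (hn : 2 ≤ n) (hΩ : CausallyConvex Ω) (h : IsRegionData U fm fp)
    (heq : Ω = region U fm fp) (z : upper U (fun x => -fp x) fun x => -fm x) :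
    z.1.2 = -fm z.1.1 ↔ IsTIF Ω (homeoIF hn hΩ h heq z) := by
  constructor
  · intro hz
    have hv := (vertical_inextensible h heq z.2.1).2
    refine ⟨_, _, hv, ?_⟩
    obtain ⟨z', -, -, ht, hpast⟩ := hv.exists_tendsto hn hΩ h heq
    rw [hpast, homeoIF_val]
    congr 1
    have ht' : Tendsto (fun s => (z.1.1, s)) (𝓝[>] (fm z.1.1)) (𝓝 z') := by
      rw [← map_coe_Ioo_atBot (h.lt _ z.2.1)]
      exact tendsto_map'_iff.2 ht
    have hcont : Continuous fun s : ℝ => (z.1.1, s) := by fun_prop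
    rw [← tendsto_nhds_unique (hcont.continuousWithinAt (x := fm z.1.1) (s := Ioi _)) ht']
    exact Prod.ext rfl hz
  · rintro ⟨I, γ, hγ, hP⟩
    obtain ⟨z', h1, h2, -, hpast⟩ := hγ.exists_tendsto hn hΩ h heq
    have hz' : timeReversal n z' ∈ upper U (fun x => -fp x) fun x => -fm x :=
      ⟨h1, neg_lt_neg (h2 ▸ h.lt _ h1), (neg_inj.2 h2).le⟩
    have : homeoIF hn hΩ h heq z = homeoIF hn hΩ h heq ⟨_, hz'⟩ :=
      Subtype.ext (hP.trans hpast)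
    rw [(homeoIF hn hΩ h heq).injective this]
    exact neg_inj.2 h2

/-- The upper boundary is the graph of the upper function. -/
def upperBoundaryHomeo (h : ∀ x ∈ U, fm x < fp x) :
    {z : upper U fm fp // z.1.2 = fp z.1.1} ≃ₜ graphOver U fp where
  toFun z := ⟨z.1.1, z.1.2.1, z.2⟩
  invFun z := ⟨⟨z.1, z.2.1, by rw [z.2.2]; exact h _ z.2.1, z.2.2.le⟩, z.2.2⟩
  left_inv _ := rfl
  right_inv _ := rfl
  continuous_toFun := by fun_prop
  continuous_invFun := by fun_prop

lemma nonempty_futureCausalBoundary_homeo (hn : 2 ≤ n) (hΩ : CausallyConvex Ω)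
    (h : IsRegionData U fm fp) (heq : Ω = region U fm fp) :
    Nonempty (FutureCausalBoundary Ω ≃ₜ graphOver U fp) :=
  ⟨((homeoIP hn hΩ h heq).subtype (isTIP_homeoIP_iff hn hΩ h heq)).symm.trans
    (upperBoundaryHomeo h.lt)⟩

lemma nonempty_pastCausalBoundary_homeo (hn : 2 ≤ n) (hΩ : CausallyConvex Ω)
    (h : IsRegionData U fm fp) (heq : Ω = region U fm fp) :
    Nonempty (PastCausalBoundary Ω ≃ₜ graphOver U fm) := by
  refine ⟨(((homeoIF hn hΩ h heq).subtype (isTIF_homeoIF_iff hn hΩ h heq)).symm.trans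
    (upperBoundaryHomeo h.reverse.lt)).trans ((timeReversal n).subtype fun z => ?_)⟩
  exact and_congr_right fun _ => neg_eq_iff_eq_neg.symm

end Charts

/-! ### The causal completion -/

/-- The region between two graphs together with both graphs. -/
def band (U : Set (Sphere n)) (fm fp : Sphere n → ℝ) : Set (Ein n) :=
  {p | p.1 ∈ U ∧ fm p.1 ≤ p.2 ∧ p.2 ≤ fp p.1}

section Completion

variable {U : Set (Sphere n)} {fm fp : Sphere n → ℝ} {Ω : Set (Ein n)}

/-- The inclusion of the region with its upper boundary. -/
def upperToBand (z : upper U fm fp) : band U fm fp := ⟨z.1, z.2.1, z.2.2.1.le, z.2.2.2⟩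

/-- The inclusion of the region with its lower boundary, the latter in reversed time. -/
def lowerToBand (z : upper U (fun x => -fp x) fun x => -fm x) : band U fm fp :=
  ⟨timeReversal n z.1, z.2.1, le_neg.1 z.2.2.2, neg_le.1 z.2.2.1.le⟩

lemma isOpenEmbedding_upperToBand (h : Continuous fm) :
    IsOpenEmbedding (upperToBand : upper U fm fp → band U fm fp) := by
  refine ⟨IsEmbedding.subtypeVal.of_comp_iff.1
    (IsEmbedding.subtypeVal : IsEmbedding (Subtype.val : upper U fm fp → Ein n)), ?_⟩
  have : range (upperToBand : upper U fm fp → band U fm fp) = {z | fm z.1.1 < z.1.2} := by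
    ext z
    constructor
    · rintro ⟨z, rfl⟩
      exact z.2.2.1
    · intro hz
      exact ⟨⟨z.1, z.2.1, hz, z.2.2.2⟩, rfl⟩
  rw [this]
  exact isOpen_lt (h.comp (continuous_fst.comp continuous_subtype_val))
    (continuous_snd.comp continuous_subtype_val)

lemma isOpenEmbedding_lowerToBand (h : Continuous fp) :
    IsOpenEmbedding (lowerToBand :
      upper U (fun x => -fp x) (fun x => -fm x) → band U fm fp) := by
  have hemb : IsEmbedding fun z : upper U (fun x => -fp x) (fun x => -fm x) =>
      timeReversal n z.1 := (timeReversal n).isEmbedding.comp IsEmbedding.subtypeVal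
  refine ⟨IsEmbedding.subtypeVal.of_comp_iff.1 hemb, ?_⟩
  have : range (lowerToBand : upper U (fun x => -fp x) (fun x => -fm x) → band U fm fp) =
      {z | z.1.2 < fp z.1.1} := by
    ext z
    constructor
    · rintro ⟨z, rfl⟩
      exact neg_lt.1 z.2.2.1
    · intro hz
      exact ⟨⟨timeReversal n z.1, z.2.1, neg_lt_neg hz, neg_le_neg z.2.2.1⟩,
        Subtype.ext ((timeReversal n).left_inv z.1)⟩
  rw [this]
  exact isOpen_lt (continuous_snd.comp continuous_subtype_val)
    (h.comp (continuous_fst.comp continuous_subtype_val))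

lemma setOf_chron_eq_pastOf (hn : 2 ≤ n) (hΩ : CausallyConvex Ω) (p : Ω) :
    {q | Chron Ω q p} = IsCausalChart.pastOf Subtype.val p.1 := by
  ext q
  exact chron_iff hn hΩ q p

lemma setOf_chron_eq_pastOf_timeReversal (hn : 2 ≤ n) (hΩ : CausallyConvex Ω) (p : Ω) :
    {q | Chron Ω p q} =
      IsCausalChart.pastOf (fun p : Ω => timeReversal n p) (timeReversal n p.1) := by
  ext q
  rw [mem_ofPred_eq, chron_iff hn hΩ p q]
  simp only [IsCausalChart.pastOf, mem_ofPred_eq, timeReversal_fst, timeReversal_snd,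
    sphereDist_comm p.1.1, sub_neg_eq_add, neg_add_eq_sub]

/-- The map from ideal points to the region with both boundaries. -/
def idealToBand (hn : 2 ≤ n) (hΩ : CausallyConvex Ω) (h : IsRegionData U fm fp)
    (heq : Ω = region U fm fp) : IP Ω ⊕ IF Ω → band U fm fp :=
  Sum.elim (fun P => upperToBand ((homeoIP hn hΩ h heq).symm P))
    fun F => lowerToBand ((homeoIF hn hΩ h heq).symm F)

section

variable (hn : 2 ≤ n) (hΩ : CausallyConvex Ω) (h : IsRegionData U fm fp)
  (heq : Ω = region U fm fp)

lemma continuous_idealToBand : Continuous (idealToBand hn hΩ h heq) :=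
  ((isOpenEmbedding_upperToBand h.short_fm.continuous).continuous.comp
    (homeoIP hn hΩ h heq).symm.continuous).sumElim
  ((isOpenEmbedding_lowerToBand h.short_fp.continuous).continuous.comp
    (homeoIF hn hΩ h heq).symm.continuous)

/-- Openness on the disjoint union passes to the quotient, so the quotient topology is that of the
band. -/
lemma isOpenMap_idealToBand : IsOpenMap (idealToBand hn hΩ h heq) :=
  IsOpenMap.sumElim
    ((isOpenEmbedding_upperToBand h.short_fm.continuous).isOpenMap.comp
      (homeoIP hn hΩ h heq).symm.isOpenMap)
    ((isOpenEmbedding_lowerToBand h.short_fp.continuous).isOpenMap.comp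
      (homeoIF hn hΩ h heq).symm.isOpenMap)

lemma surjective_idealToBand : Function.Surjective (idealToBand hn hΩ h heq) := by
  intro z
  rcases z.2.2.1.lt_or_eq with hlt | heq'
  · refine ⟨Sum.inl (homeoIP hn hΩ h heq ⟨z.1, z.2.1, hlt, z.2.2.2⟩), ?_⟩
    rw [idealToBand, Sum.elim_inl, Homeomorph.symm_apply_apply]
    rfl
  · refine ⟨Sum.inr (homeoIF hn hΩ h heq ⟨timeReversal n z.1, z.2.1, neg_lt_neg ?_,
      neg_le_neg z.2.2.1⟩), ?_⟩
    · rw [← heq']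
      exact h.lt _ z.2.1
    · rw [idealToBand, Sum.elim_inr, Homeomorph.symm_apply_apply]
      exact Subtype.ext ((timeReversal n).left_inv z.1)

lemma idealToBand_eq_of_identified {a b : IP Ω ⊕ IF Ω} (hab : Identified Ω a b) :
    idealToBand hn hΩ h heq a = idealToBand hn hΩ h heq b := by
  obtain ⟨p, P, F, hP, hF, rfl, rfl⟩ := hab
  have hp : p.1 ∈ region U fm fp := heq ▸ p.2
  have h1 : P = homeoIP hn hΩ h heq ⟨p.1, region_subset_upper hp⟩ :=
    Subtype.ext (hP.trans (setOf_chron_eq_pastOf hn hΩ p))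
  have h2 : F = homeoIF hn hΩ h heq
      ⟨timeReversal n p.1, hp.1, neg_lt_neg hp.2.2, (neg_lt_neg hp.2.1).le⟩ :=
    Subtype.ext (hF.trans (setOf_chron_eq_pastOf_timeReversal hn hΩ p))
  rw [h1, h2, idealToBand, Sum.elim_inl, Sum.elim_inr, Homeomorph.symm_apply_apply,
    Homeomorph.symm_apply_apply]
  exact Subtype.ext ((timeReversal n).left_inv p.1).symm

/-- A common value is strictly above the lower graph and strictly below the upper one, hence a point
of `Ω`: nothing else is glued. -/
lemma identified_of_idealToBand_eq {P : IP Ω} {F : IF Ω}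
    (hPF : idealToBand hn hΩ h heq (Sum.inl P) = idealToBand hn hΩ h heq (Sum.inr F)) :
    Identified Ω (Sum.inl P) (Sum.inr F) := by
  obtain ⟨z, rfl⟩ := (homeoIP hn hΩ h heq).surjective P
  obtain ⟨w, rfl⟩ := (homeoIF hn hΩ h heq).surjective F
  rw [idealToBand, Sum.elim_inl, Sum.elim_inr, Homeomorph.symm_apply_apply,
    Homeomorph.symm_apply_apply] at hPF
  have hzw : z.1 = timeReversal n w.1 := congrArg Subtype.val hPF
  have hwz : w.1 = timeReversal n z.1 := by
    rw [hzw]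
    exact ((timeReversal n).left_inv w.1).symm
  have hz : z.1 ∈ Ω := by
    rw [heq]
    refine ⟨z.2.1, z.2.2.1, ?_⟩
    have := w.2.2.1
    rw [hwz] at this
    exact neg_lt_neg_iff.1 this
  refine ⟨⟨z.1, hz⟩, _, _, (setOf_chron_eq_pastOf hn hΩ ⟨z.1, hz⟩).symm, ?_, rfl, rfl⟩
  rw [homeoIF_val, setOf_chron_eq_pastOf_timeReversal hn hΩ ⟨z.1, hz⟩, hwz]

/-- The causal completion of a region is the region with both boundaries. -/
def completionHomeo : CausalCompletion Ω ≃ₜ band U fm fp :=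
  (Equiv.ofBijective (Quot.lift (idealToBand hn hΩ h heq)
    fun _ _ => idealToBand_eq_of_identified hn hΩ h heq) (by
      constructor
      · rintro ⟨a⟩ ⟨b⟩ hab
        replace hab : idealToBand hn hΩ h heq a = idealToBand hn hΩ h heq b := hab
        rcases a with P | F <;> rcases b with P' | F'
        · exact congrArg _ (congrArg Sum.inl ((homeoIP hn hΩ h heq).symm.injective
            ((isOpenEmbedding_upperToBand h.short_fm.continuous).injective hab)))
        · exact Quot.sound (identified_of_idealToBand_eq hn hΩ h heq hab)
        · exact (Quot.sound (identified_of_idealToBand_eq hn hΩ h heq hab.symm)).symm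
        · exact congrArg _ (congrArg Sum.inr ((homeoIF hn hΩ h heq).symm.injective
            ((isOpenEmbedding_lowerToBand h.short_fp.continuous).injective hab)))
      · intro z
        obtain ⟨a, ha⟩ := surjective_idealToBand hn hΩ h heq z
        exact ⟨Quot.mk _ a, ha⟩)).toHomeomorphOfContinuousOpen
    (continuous_quot_lift _ (continuous_idealToBand hn hΩ h heq)) (by
      intro O hO
      have : (Quot.lift (idealToBand hn hΩ h heq)
          fun _ _ => idealToBand_eq_of_identified hn hΩ h heq) '' O =
          idealToBand hn hΩ h heq '' (Quot.mk _ ⁻¹' O) := by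
        ext z
        constructor
        · rintro ⟨⟨a⟩, ha, rfl⟩
          exact ⟨a, ha, rfl⟩
        · rintro ⟨a, ha, rfl⟩
          exact ⟨_, ha, rfl⟩
      change IsOpen (Quot.lift (idealToBand hn hΩ h heq) _ '' O)
      rw [this]
      exact isOpenMap_idealToBand hn hΩ h heq _ (hO.preimage continuous_quot_mk))

end

/-- The region with both boundaries is a product. -/
def bandHomeo (h : IsRegionData U fm fp) : band U fm fp ≃ₜ U × Icc (0 : ℝ) 1 where
  toFun z := (⟨z.1.1, z.2.1⟩, ⟨(z.1.2 - fm z.1.1) / (fp z.1.1 - fm z.1.1), by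
    have := sub_pos.2 (h.lt _ z.2.1)
    have h1 := z.2.2.1
    have h2 := z.2.2.2
    exact ⟨div_nonneg (by linarith) this.le, (div_le_one this).2 (by linarith)⟩⟩)
  invFun y := ⟨(y.1.1, fm y.1.1 + y.2.1 * (fp y.1.1 - fm y.1.1)), y.1.2, by
    have := sub_pos.2 (h.lt _ y.1.2)
    have h1 := y.2.2.1
    have h2 := y.2.2.2
    constructor <;> simp only <;> nlinarith⟩
  left_inv z := by
    have := (sub_pos.2 (h.lt _ z.2.1)).ne'
    refine Subtype.ext (Prod.ext rfl ?_)
    simp only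
    field_simp
    ring
  right_inv y := by
    have := (sub_pos.2 (h.lt _ y.1.2)).ne'
    refine Prod.ext rfl (Subtype.ext ?_)
    simp only
    field_simp
    ring
  continuous_toFun := by
    have h1 := h.short_fm.continuous
    have h2 := h.short_fp.continuous
    refine Continuous.prodMk (by fun_prop) (Continuous.subtype_mk ?_ _)
    exact Continuous.div₀ (by fun_prop) (by fun_prop)
      fun z => (sub_pos.2 (h.lt _ z.2.1)).ne'
  continuous_invFun := by
    have h1 := h.short_fm.continuous
    have h2 := h.short_fp.continuous
    refine Continuous.subtype_mk ?_ _
    fun_prop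

/-- The graph of a continuous function is homeomorphic to its domain. -/
def graphOverHomeo (U : Set (Sphere n)) {f : Sphere n → ℝ} (hf : Continuous f) :
    graphOver U f ≃ₜ U where
  toFun p := ⟨p.1.1, p.2.1⟩
  invFun x := ⟨(x.1, f x.1), x.2, rfl⟩
  left_inv p := Subtype.ext (Prod.ext rfl p.2.2.symm)
  right_inv _ := rfl
  continuous_toFun := by fun_prop
  continuous_invFun := by fun_prop

/-! ### Cauchy hypersurfaces -/

/-- The points of a Cauchy hypersurface are not causally related. -/
lemma IsCauchyHypersurface.eq_of_sphereDist_le (hn : 2 ≤ n) (hΩ : CausallyConvex Ω)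
    (heq : Ω = region U fm fp) {S : Set (Ein n)}
    (hS : IsCauchyHypersurface Ω S) {p q : Ein n} (hp : p ∈ S) (hq : q ∈ S)
    (hle : sphereDist p.1 q.1 ≤ q.2 - p.2) : p = q := by
  by_contra hne
  obtain ⟨hlt, c, hc, hcp, hcq⟩ := exists_isSlowPath_of_sphereDist_le hn hne hle
  have hpΩ := hS.1 hp
  have hqΩ := hS.1 hq
  have hmid : ∀ s ∈ Icc p.2 q.2, (c s, s) ∈ Ω :=
    hΩ _ _ _ hlt (hc.isCausalCurve ordConnected_Icc (nontrivial_Icc hlt))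
      (by simpa only [hcp] using hpΩ) (by simpa only [hcq] using hqΩ)
  rw [heq] at hpΩ hqΩ
  -- The causal curve from `p` to `q` is prolonged vertically, down to the graph of `fm` and up to
  -- that of `fp`. The result is inextensible and would meet `S` twice.
  let c₁ : ℝ → Sphere n := fun s => if s ≤ q.2 then c s else q.1
  let c₂ : ℝ → Sphere n := fun s => if s ≤ p.2 then p.1 else c₁ s
  have hc₁ : IsSlowPath 1 c₁ := hc.glue (isSlowPath_const q.1 zero_le_one) hcq
  have hc₂ : IsSlowPath 1 c₂ := (isSlowPath_const p.1 zero_le_one).glue hc₁ (by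
    simp only [c₁, if_pos hlt.le, hcp])
  have hc₂p : ∀ s, s ≤ p.2 → c₂ s = p.1 := fun s hs => if_pos hs
  have hc₂q : ∀ s, q.2 ≤ s → c₂ s = q.1 := by
    intro s hs
    simp only [c₂, c₁, if_neg (not_le_of_gt (hlt.trans_le hs))]
    split_ifs with h'
    · rw [le_antisymm h' hs, hcq]
    · rfl
  have hin := hc₂.inextensible (Ω := Ω) (a := fm p.1) (b := fp q.1)
    (hpΩ.2.1.trans (hlt.trans hqΩ.2.2)) (fun s hs => by
      rcases le_or_gt s p.2 with h1 | h1
      · rw [hc₂p s h1, heq]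
        exact ⟨hpΩ.1, hs.1, h1.trans_lt hpΩ.2.2⟩
      rcases le_or_gt s q.2 with h2 | h2
      · simp only [c₂, c₁, if_neg (not_le_of_gt h1), if_pos h2]
        exact hmid s ⟨h1.le, h2⟩
      · rw [hc₂q s h2.le, heq]
        exact ⟨hqΩ.1, hqΩ.2.1.trans h2, hs.2⟩)
    (by rw [hc₂p _ hpΩ.2.1.le, heq]; exact fun h => lt_irrefl _ h.2.1)
    (by rw [hc₂q _ hqΩ.2.2.le, heq]; exact fun h => lt_irrefl _ h.2.2)
  have huniq := (hS.2 _ _ hin.1 hin.2).unique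
    (y₁ := p.2) (y₂ := q.2) ⟨⟨hpΩ.2.1, hlt.trans hqΩ.2.2⟩, by rwa [hc₂p _ le_rfl]⟩
    ⟨⟨hpΩ.2.1.trans hlt, hqΩ.2.2⟩, by rwa [hc₂q _ le_rfl]⟩
  exact hlt.ne huniq

/-- Cauchy hypersurfaces are graphs of `1`-Lipschitz functions. -/
lemma IsCauchyHypersurface.exists_eq_graphOver (hn : 2 ≤ n) (hΩ : CausallyConvex Ω)
    (h : IsRegionData U fm fp) (heq : Ω = region U fm fp) {S : Set (Ein n)}
    (hS : IsCauchyHypersurface Ω S) : ∃ f, IsShort f ∧ S = graphOver U f := by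
  have hex : ∀ x, ∃ s : ℝ, x ∈ U → (x, s) ∈ S := by
    intro x
    by_cases hx : x ∈ U
    · obtain ⟨hv₁, hv₂⟩ := vertical_inextensible h heq hx
      obtain ⟨s, hs, -⟩ := hS.2 _ _ hv₁ hv₂
      exact ⟨s, fun _ => hs.2⟩
    · exact ⟨0, fun h => absurd h hx⟩
  choose g hg using hex
  have key : ∀ x ∈ U, ∀ y ∈ U, g x - g y ≤ sphereDist x y := by
    intro x hx y hy
    by_contra! hcon
    have := hS.eq_of_sphereDist_le hn hΩ heq (hg y hy) (hg x hx)
      (by simpa only [sphereDist_comm y x] using hcon.le)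
    rw [Prod.mk.injEq] at this
    rw [this.2, sub_self] at hcon
    exact absurd (sphereDist_nonneg x y) (not_le.2 hcon)
  have hlip : LipschitzOneOn g U := fun x hx y hy => abs_le.2
    ⟨by have := key y hy x hx; rw [sphereDist_comm] at this; linarith, key x hx y hy⟩
  obtain ⟨f, hf, hgf⟩ := hlip.exists_extension
  refine ⟨f, hf, ?_⟩
  ext p
  constructor
  · intro hp
    have hpU : p.1 ∈ U := by
      have := hS.1 hp
      rw [heq] at this
      exact this.1
    refine ⟨hpU, ?_⟩
    rw [← hgf hpU]
    -- Two points on the same vertical line are causally related, so `S` has only one point there.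
    rcases le_total p.2 (g p.1) with h1 | h1
    · exact congrArg Prod.snd (hS.eq_of_sphereDist_le hn hΩ heq hp (hg _ hpU)
        (by simpa using h1))
    · exact (congrArg Prod.snd (hS.eq_of_sphereDist_le hn hΩ heq (hg _ hpU) hp
        (by simpa using h1))).symm
  · rintro ⟨hpU, hp⟩
    rw [← hgf hpU] at hp
    have : p = (p.1, g p.1) := Prod.ext rfl hp
    rw [this]
    exact hg _ hpU

/-! ### Existence of a Cauchy hypersurface -/

/-- A strictly `1`-Lipschitz function between the two functions defining a region. -/
lemma IsRegionData.exists_strictly_short (h : IsRegionData U fm fp) :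
    ∃ g : Sphere n → ℝ, Continuous g ∧ (∀ x ∈ U, fm x < g x ∧ g x < fp x) ∧
      ∀ x ∈ U, ∀ y ∈ U, x ≠ y → g x - g y < sphereDist x y := by
  -- A dense sequence needs a non-empty region; if the region is empty, so is `U`.
  rcases (region U fm fp).eq_empty_or_nonempty with hemp | hne
  · have hU : ∀ x, x ∉ U := by
      intro x hx
      obtain ⟨t, h1, h2⟩ := exists_between (h.lt x hx)
      have : (x, t) ∈ region U fm fp := ⟨hx, h1, h2⟩
      rw [hemp] at this
      exact this
    exact ⟨fm, h.short_fm.continuous, fun x hx => absurd hx (hU x), fun x hx => absurd hx (hU x)⟩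
  have : Nonempty (region U fm fp) := hne.to_subtype
  obtain ⟨u, hu⟩ := TopologicalSpace.exists_dense_seq (region U fm fp)
  obtain ⟨C, hC⟩ := isCompact_univ.bddAbove_image h.short_fp.continuous.continuousOn
  -- `φ p` is the maximum of `fm` and the past light cone of `p`. It satisfies every required
  -- inequality weakly, and each strictly for suitable `p`. Averaging over a dense sequence makes
  -- them all strict, since one strict term is enough.
  let φ : Ein n → Sphere n → ℝ := fun p x => max (fm x) (p.2 - sphereDist x p.1)
  have hφshort : ∀ p, IsShort (φ p) := by
    intro p x y
    have h1 := h.short_fm x y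
    have h2 := sphereDist_triangle y x p.1
    rw [sphereDist_comm y x] at h2
    rw [sub_le_iff_le_add]
    refine max_le ?_ ?_
    · linarith [le_max_left (fm y) (p.2 - sphereDist y p.1)]
    · linarith [le_max_right (fm y) (p.2 - sphereDist y p.1)]
  have hφcont : ∀ x, Continuous fun p : region U fm fp => φ p.1 x := fun x =>
    continuous_const.max ((continuous_snd.comp continuous_subtype_val).sub
      (continuous_sphereDist_comp continuous_const (continuous_fst.comp continuous_subtype_val)))
  have hsum : ∀ x, Summable fun k : ℕ => φ (u k).1 x / 2 / 2 ^ k := by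
    intro x
    refine Summable.of_norm_bounded (hasSum_geometric_two' (|fm x| + |C|)).summable fun k => ?_
    rw [norm_div, norm_div, Real.norm_eq_abs, norm_pow, Real.norm_two]
    have h1 : (u k).1.2 ≤ C := (u k).2.2.2.le.trans (hC ⟨_, mem_univ _, rfl⟩)
    have h2 := sphereDist_nonneg x (u k).1.1
    have : |φ (u k).1 x| ≤ |fm x| + |C| := by
      refine abs_le.2 ⟨?_, max_le ?_ ?_⟩
      · linarith [le_max_left (fm x) ((u k).1.2 - sphereDist x (u k).1.1), neg_abs_le (fm x),
          abs_nonneg C]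
      · linarith [le_abs_self (fm x), abs_nonneg C]
      · linarith [le_abs_self C, abs_nonneg (fm x)]
    gcongr
  have hpos : ∀ k : ℕ, (0 : ℝ) < 2 ^ k := fun k => by positivity
  -- The weights `1 / 2 / 2 ^ k` add up to `1`, so bounds on each `φ (u k).1` pass to `g`.
  let g : Sphere n → ℝ := fun x => ∑' k : ℕ, φ (u k).1 x / 2 / 2 ^ k
  have hg : ∀ x, HasSum (fun k : ℕ => φ (u k).1 x / 2 / 2 ^ k) (g x) := fun x => (hsum x).hasSum
  have hsub : ∀ x y, HasSum (fun k : ℕ => (φ (u k).1 x - φ (u k).1 y) / 2 / 2 ^ k) (g x - g y) := by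
    intro x y
    simpa only [sub_div] using (hg x).sub (hg y)
  have hgshort : IsShort g := by
    intro x y
    refine hasSum_le (fun k => ?_) (hsub x y) (hasSum_geometric_two' (sphereDist x y))
    have := hφshort (u k).1 x y
    gcongr
  refine ⟨g, hgshort.continuous, fun x hx => ⟨?_, ?_⟩, fun x hx y hy hxy => ?_⟩
  · obtain ⟨t, h1, h2⟩ := exists_between (h.lt x hx)
    obtain ⟨k, hk⟩ := hu.exists_mem_open (isOpen_lt (continuous_const (y := fm x)) (hφcont x))
      ⟨⟨(x, t), hx, h1, h2⟩, by simp [φ, h1]⟩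
    refine hasSum_lt (i := k) (fun i => ?_) ?_ (hasSum_geometric_two' (fm x)) (hg x)
    · have : fm x ≤ φ (u i).1 x := le_max_left _ _
      simp only
      gcongr
    · have : fm x < φ (u k).1 x := hk
      gcongr
  · have key : ∀ k, φ (u k).1 x < fp x := by
      intro k
      refine max_lt (h.lt x hx) ?_
      have h1 := (u k).2.2.2
      have h2 := h.short_fp (u k).1.1 x
      rw [sphereDist_comm] at h2
      linarith
    refine hasSum_lt (i := 0) (fun i => ?_) ?_ (hg x) (hasSum_geometric_two' (fp x))
    · have := (key i).le
      simp only
      gcongr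
    · have := key 0
      gcongr
  · have hd : 0 < sphereDist x y :=
      lt_of_not_ge fun hle => hxy (sphereDist_eq_zero hle)
    -- For the cone with vertex `(y, t)` the function equals `t > fm y` at `y`, and both terms of
    -- the maximum at `x` are less than `t + d(x, y)`. This strict inequality is open in the vertex,
    -- so some `u k` satisfies it.
    obtain ⟨t, h1, h2⟩ := exists_between (h.lt y hy)
    have hmem : φ (y, t) x - φ (y, t) y < sphereDist x y := by
      have h3 := h.short_fm x y
      simp only [φ, sphereDist_self, sub_zero, max_eq_right h1.le]
      rw [sub_lt_iff_lt_add]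
      exact max_lt (by linarith) (by linarith)
    obtain ⟨k, hk⟩ := hu.exists_mem_open (isOpen_lt ((hφcont x).sub (hφcont y))
      (continuous_const (y := sphereDist x y))) ⟨⟨(y, t), hy, h1, h2⟩, hmem⟩
    refine hasSum_lt (i := k) (fun i => ?_) ?_ (hsub x y)
      (hasSum_geometric_two' (sphereDist x y))
    · have := hφshort (u i).1 x y
      simp only
      gcongr
    · have : φ (u k).1 x - φ (u k).1 y < sphereDist x y := hk
      gcongr

/-- Along a causal curve the time minus `g` is strictly increasing because `g` is strictly
`1`-Lipschitz. An inextensible curve runs from the graph of `fm` to that of `fp`, so this quantity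
changes sign and vanishes exactly once. -/
lemma exists_isCauchyHypersurface (hn : 2 ≤ n) (hΩ : CausallyConvex Ω)
    (h : IsRegionData U fm fp) (heq : Ω = region U fm fp) :
    ∃ S, IsCauchyHypersurface Ω S := by
  obtain ⟨g, hg, hbetween, hstrict⟩ := h.exists_strictly_short
  refine ⟨graphOver U g, fun p hp => ?_, fun I γ hγ hγ' => ?_⟩
  · rw [heq]
    exact ⟨hp.1, hp.2 ▸ (hbetween _ hp.1).1, hp.2 ▸ (hbetween _ hp.1).2⟩
  have hmem : ∀ s ∈ I, (γ s).1 ∈ U := by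
    intro s hs
    have := hγ.2.1 s hs
    rw [heq] at this
    exact this.1
  have : Nonempty I := hγ.1.2.1.nonempty.to_subtype
  let k : ℝ → ℝ := fun s => (γ s).2 - g (γ s).1
  have hkc : Continuous fun z : Ein n => z.2 - g z.1 := by fun_prop
  have hk : ContinuousOn k I := hkc.comp_continuousOn hγ.1.2.2.1
  have hmono : StrictMonoOn k I := by
    intro s hs s' hs' hss'
    obtain ⟨h1, h2⟩ := hγ.1.sphereDist_le_of_mem hs hs' hss'
    simp only [k]
    by_cases hx : (γ s).1 = (γ s').1
    · rw [hx]
      linarith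
    · have := hstrict _ (hmem s' hs') _ (hmem s hs) (Ne.symm hx)
      rw [sphereDist_comm] at this
      linarith
  obtain ⟨z, hz1, hz2, ht, -⟩ := hγ.exists_tendsto hn hΩ h heq
  obtain ⟨z', hz1', hz2', ht', -⟩ := hγ'.exists_tendsto hn hΩ h heq
  obtain ⟨b, hb⟩ := (((hkc.tendsto z).comp ht).eventually_const_lt (u := 0) (by
    rw [hz2]; linarith [hbetween _ hz1])).exists
  obtain ⟨a, ha⟩ := (((hkc.tendsto z').comp ht').eventually_lt_const (u := 0) (by
    rw [hz2']; linarith [hbetween _ hz1'])).exists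
  obtain ⟨s, hs, hs0⟩ := hγ.1.1.isPreconnected.intermediate_value a.2 b.2 hk
    (show (0 : ℝ) ∈ Icc (k a) (k b) from ⟨le_of_lt ha, le_of_lt hb⟩)
  refine ⟨s, ⟨hs, hmem s hs, sub_eq_zero.1 hs0⟩, ?_⟩
  rintro s' ⟨hs', -, hs0'⟩
  exact hmono.injOn hs' hs ((sub_eq_zero.2 hs0').trans hs0.symm)

end Completion

/-! ### Charts with boundary -/

/-- The half-space as a product. -/
def halfSpaceHomeo (m : ℕ) [NeZero (m + 1)] :
    ModelProd (EuclideanSpace ℝ (Fin m)) (EuclideanHalfSpace 1) ≃ₜ EuclideanHalfSpace (m + 1) where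
  toFun y := ⟨WithLp.toLp 2 (Fin.cons (y.2.1 0) y.1), y.2.2⟩
  invFun x := (WithLp.toLp 2 (Fin.tail x.1), ⟨WithLp.toLp 2 fun _ => x.1 0, x.2⟩)
  left_inv y := by
    refine Prod.ext ?_ (Subtype.ext ?_)
    · ext i
      simp [Fin.tail]
    · ext i
      rw [Subsingleton.elim i 0]
      rfl
  right_inv x := by
    refine Subtype.ext ?_
    ext i
    exact congrFun (Fin.cons_self_tail (n := m) (α := fun _ => ℝ) x.1) i
  continuous_toFun := by
    refine Continuous.subtype_mk ((PiLp.continuous_toLp 2 _).comp (continuous_pi fun i => ?_)) _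
    have h1 : Continuous fun y : ModelProd (EuclideanSpace ℝ (Fin m)) (EuclideanHalfSpace 1) =>
        y.1 := continuous_fst
    have h2 : Continuous fun y : ModelProd (EuclideanSpace ℝ (Fin m)) (EuclideanHalfSpace 1) =>
        y.2.1 := continuous_subtype_val.comp continuous_snd
    refine Fin.cases ?_ (fun i => ?_) i
    · simp only [Fin.cons_zero]
      fun_prop
    · simp only [Fin.cons_succ]
      fun_prop
  continuous_invFun := by
    have h1 : Continuous fun x : EuclideanHalfSpace (m + 1) => x.1 := continuous_subtype_val
    refine Continuous.prodMk ((PiLp.continuous_toLp 2 _).comp (continuous_pi fun i => ?_))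
      (Continuous.subtype_mk ((PiLp.continuous_toLp 2 _).comp (continuous_pi fun i => ?_)) _)
    · simp only [Fin.tail]
      fun_prop
    · fun_prop

/-- Charts of the sphere on the open set `U` times the boundary charts of `[0,1]` have values in
`ℝᵐ` times a half-line, which `halfSpaceHomeo` turns into the half-space. -/
lemma isTopManifoldWithBoundary_of_homeo [NeZero n] {U : Set (Sphere n)} (hU : IsOpen U)
    {X : Type} [TopologicalSpace X] (e : X ≃ₜ U × Icc (0 : ℝ) 1) :
    IsTopManifoldWithBoundary n X := by
  refine ⟨e.isEmbedding.t2Space, e.isEmbedding.secondCountableTopology, ?_⟩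
  obtain ⟨m, rfl⟩ : ∃ m, n = m + 1 := ⟨n - 1, by have := NeZero.pos n; omega⟩
  have : Fact (Module.finrank ℝ (EuclideanSpace ℝ (Fin (m + 1))) = m + 1) := ⟨by simp⟩
  let V : TopologicalSpace.Opens (Sphere (m + 1)) := ⟨U, hU⟩
  let e' : X ≃ₜ V × Icc (0 : ℝ) 1 := e
  let := e'.toOpenPartialHomeomorph.singletonChartedSpace rfl
  let := (halfSpaceHomeo m).toOpenPartialHomeomorph.singletonChartedSpace rfl
  let : ChartedSpace (ModelProd (EuclideanSpace ℝ (Fin m)) (EuclideanHalfSpace 1)) X :=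
    ChartedSpace.comp _ (V × Icc (0 : ℝ) 1) _
  exact ⟨ChartedSpace.comp _
    (ModelProd (EuclideanSpace ℝ (Fin m)) (EuclideanHalfSpace 1)) _⟩

end EinsteinUniverse

end

/-! ### Assembly of the five assertions -/

open EinsteinUniverse
theorem proposition7 {n : ℕ} [NeZero n] (hn : 2 ≤ n) (Ω : Set (Ein n)) (hopen : IsOpen Ω)
    (hconvex : CausallyConvex Ω) (hconj : NoConjugatePoints Ω) :
    (∃ (U : Set (Sphere n)) (fm fp : Sphere n → ℝ), IsRegionBetween Ω U fm fp) ∧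
    (∀ (U : Set (Sphere n)) (fm fp : Sphere n → ℝ), IsRegionBetween Ω U fm fp →
      Nonempty (FutureCausalBoundary Ω ≃ₜ graphOver U fp) ∧
      Nonempty (PastCausalBoundary Ω ≃ₜ graphOver U fm)) ∧
    (∃ S : Set (Ein n), IsCauchyHypersurface Ω S) ∧
    (∀ S : Set (Ein n), IsCauchyHypersurface Ω S →
      Nonempty (CausalCompletion Ω ≃ₜ S × Icc (0 : ℝ) 1)) ∧
    IsTopManifoldWithBoundary n (CausalCompletion Ω) := by
  obtain ⟨U, fm, fp, h, heq⟩ := hconvex.exists_regionData hn hopen hconj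
  have e : CausalCompletion Ω ≃ₜ U × Icc (0 : ℝ) 1 :=
    (completionHomeo hn hconvex h heq).trans (bandHomeo h)
  refine ⟨⟨U, fm, fp, heq ▸ h.isRegionBetween⟩, fun V gm gp hV => ?_,
    exists_isCauchyHypersurface hn hconvex h heq, fun S hS => ?_,
    isTopManifoldWithBoundary_of_homeo h.isOpen e⟩
  -- The given functions are arbitrary off `V`, so they are replaced by global `1`-Lipschitz
  -- extensions, which have the same graphs over `V`.
  · obtain ⟨km, kp, hk, hm, hp, hkeq⟩ := hV.exists_regionData
    have hgraph : ∀ {f k : Sphere n → ℝ}, EqOn f k V → graphOver V f = graphOver V k :=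
      fun hfk => Set.ext fun p => and_congr_right fun hpV => by rw [hfk hpV]
    rw [hgraph hm, hgraph hp]
    exact ⟨nonempty_futureCausalBoundary_homeo hn hconvex hk hkeq,
      nonempty_pastCausalBoundary_homeo hn hconvex hk hkeq⟩
  · obtain ⟨f, hf, rfl⟩ := hS.exists_eq_graphOver hn hconvex h heq
    exact ⟨e.trans ((graphOverHomeo U hf.continuous).symm.prodCongr (Homeomorph.refl _))⟩
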